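/- For $\lambda\in\mathbb{R}$ let $e_\lambda(t)=e^{2\pi i\lambda t}$, and for $\Lambda\subseteq\mathbb{R}$ let $E(\Lambda)=\{e_\lambda\}_{\lambda\in\Lambda}$. A system of vectors in a Hilbert space $H$ is called a Riesz basis of $H$ if it is the image of an orthonormal basis of $H$ under a bounded invertible operator $H\to H$. Let $S_1\subseteq S_2\subseteq\dots\subseteq S_K\subseteq[0,1]$ be sets, each of which is a finite union of intervals. Then there exist sets $\Lambda_1\subseteq\Lambda_2\subseteq\dots\subseteq\Lambda_K\subseteq\mathbb{Z}$ such that, for every $k=1,\dots,K$, the system $E(\Lambda_k)$ is a Riesz basis of $L^2(S_k)$ (with respect to Lebesgue measure; if $S_k$ has measure zero, then $L^2(S_k)=\{0\}$ and the empty system counts as its Riesz basis). -/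

import Mathlib

open MeasureTheory

/-- A family `f` of vectors of an inner product space is a Riesz basis if it is the image of an
orthonormal (Hilbert) basis under a bounded invertible operator. -/
def IsRieszBasis {ι H : Type*} [NormedAddCommGroup H] [InnerProductSpace ℂ H] (f : ι → H) : Prop :=
  ∃ (b : HilbertBasis ι ℂ H) (T : H ≃L[ℂ] H), ∀ i, f i = T (b i)

/-- The exponential `e_x(t) = exp (2 π i x t)` of frequency `x`. -/
noncomputable def expFun (x t : ℝ) : ℂ :=
  Complex.exp (2 * Real.pi * Complex.I * x * t)

/-- The exponentials with frequencies `(freq i)` form a Riesz basis of `L²(S)`. The element `f i` of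
`L²(S)` is the class of the exponential of frequency `freq i`, which determines it. -/
def IsExpRieszBasis {ι : Type*} (freq : ι → ℝ) (S : Set ℝ) : Prop :=
  ∃ f : ι → Lp ℂ 2 (volume.restrict S),
    (∀ i, f i =ᵐ[volume.restrict S] expFun (freq i)) ∧ IsRieszBasis f

/-- A finite union of intervals of any kind (an order-connected subset of `ℝ` is an interval: open,
closed or half-open, possibly degenerate). -/
def IsFiniteUnionOfIntervals (S : Set ℝ) : Prop :=
  ∃ (L : ℕ) (I : Fin L → Set ℝ), (∀ l, (I l).OrdConnected) ∧ S = ⋃ l, I l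

/-!
The sets are regarded as subsets of the circle, given by integer-valued indicators `f`, and are
folded by `t ↦ N t`: let `F t` be the number of points of the set in the fiber above `t`. On a fiber
in which `F t = M` points lie in the set, the `M` exponentials of frequencies `0, …, M - 1` form an
invertible Vandermonde matrix. Hence if every superlevel set `{n < F}` has a Riesz basis of
exponentials with frequencies in `Λ n`, then the frequencies `N l + n` with `l ∈ Λ n` give a Riesz
basis for the set. Folding and superlevel sets respect inclusions, and so do these frequencies.

No superlevel set of `F` has more endpoints than the original set. If the latter has at least four
endpoints, then some `N` makes every superlevel set have strictly fewer. Otherwise no two endpoints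
of opposite orientation cancel under any folding, and every `F` takes only two consecutive values,
so that its variance is at most `1 / 4`; this bounds its Fourier coefficients, while averaging their
squares over `N`, as in Wiener's lemma, shows that some of them exceed the bound. Thus finitely many
foldings leave only arcs.

An arc folds to arcs. Short arcs are handled by perturbing the trigonometric system, and all others
fold to short ones, the empty set and the circle. The frequencies depend only on the length of the
arc, since translation multiplies Fourier coefficients by unimodular factors. Finally, for two arcs
of different lengths, folding by a large `N` makes, at every height, the smaller superlevel set
empty or the larger one everything, so that the frequencies are nested.
-/

open Filter Topology

/-- The sum of `f` over the fiber above `t` of multiplication by `N` on the circle `ℝ / ℤ`. For the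
indicator of a set it counts the points of the fiber in the set. -/
noncomputable def fiberSum {M : Type*} [AddCommMonoid M] (N : ℕ) (f : ℝ → M) (t : ℝ) : M :=
  ∑ j ∈ Finset.range N, f ((t + j) / N)

/-- The indicator of the superlevel set `n < F`. Indicators of sets are integer-valued functions
throughout, since they are folded to multiplicity functions by `fiberSum`. -/
def superlevel (n : ℕ) (F : ℝ → ℤ) (t : ℝ) : ℤ := if (n : ℤ) < F t then 1 else 0

lemma superlevel_eq_zero_or_one (n : ℕ) (F : ℝ → ℤ) (t : ℝ) :
    superlevel n F t = 0 ∨ superlevel n F t = 1 := by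
  unfold superlevel; split_ifs <;> simp

lemma fiberSum_mono {f g : ℝ → ℤ} (h : f ≤ g) (N : ℕ) : fiberSum N f ≤ fiberSum N g :=
  fun _ => Finset.sum_le_sum fun _ _ => h _

lemma superlevel_mono {F G : ℝ → ℤ} (h : F ≤ G) (n : ℕ) : superlevel n F ≤ superlevel n G :=
  fun t => by
    have hFG : F t ≤ G t := h t
    simp only [superlevel]
    split_ifs <;> omega

lemma measurable_fiberSum {M : Type*} [AddCommMonoid M] [MeasurableSpace M] [MeasurableAdd₂ M]
    {f : ℝ → M} (hf : Measurable f) (N : ℕ) : Measurable (fiberSum N f) :=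
  Finset.measurable_sum _ fun _ _ => hf.comp ((measurable_id.add_const _).div_const _)

lemma measurable_superlevel {F : ℝ → ℤ} (hF : Measurable F) (n : ℕ) :
    Measurable (superlevel n F) :=
  Measurable.ite (hF (measurableSet_Ioi (a := (n : ℤ)))) measurable_const measurable_const

@[to_additive periodic_sum_range_div]
lemma periodic_prod_range_div {M : Type*} [CommMonoid M] {h : ℝ → M} (hh : Function.Periodic h 1)
    (N : ℕ) : Function.Periodic (fun t => ∏ j ∈ Finset.range N, h ((t + j) / N)) 1 := by
  intro t
  rcases N with _ | N
  · simp
  · beta_reduce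
    rw [Finset.prod_range_succ, Finset.prod_range_succ']
    congr 1
    · refine Finset.prod_congr rfl fun j _ => ?_
      rw [Nat.cast_succ j]; ring_nf
    · rw [← hh ((t + (0 : ℕ)) / _)]
      congr 1
      push_cast
      field_simp
      ring

lemma periodic_fiberSum {M : Type*} [AddCommMonoid M] {f : ℝ → M} (hf : Function.Periodic f 1)
    (N : ℕ) : Function.Periodic (fiberSum N f) 1 := periodic_sum_range_div hf N

/-! ### Step functions and their jumps -/

/-- `f` is locally constant on both sides of `x`, continuous from the right, and jumps by `d`. -/
def HasJump (f : ℝ → ℤ) (x : ℝ) (d : ℤ) : Prop :=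
  (∀ᶠ y in 𝓝[<] x, f y = f x - d) ∧ ∀ᶠ y in 𝓝[>] x, f y = f x

/-- The jump of a function at a point, meaningful where the left limit exists. -/
noncomputable def jump (f : ℝ → ℤ) (x : ℝ) : ℤ := f x - Function.leftLim f x

/-- Right-continuous integer-valued step functions of period one. -/
structure IsStep (f : ℝ → ℤ) : Prop where
  periodic : Function.Periodic f 1
  exists_hasJump : ∀ x, ∃ d, HasJump f x d

/-- The total variation of a step function over one period: the sum of the sizes of its jumps. -/
noncomputable def totalJump (f : ℝ → ℤ) : ℕ := ∑ᶠ x ∈ Set.Ico (0 : ℝ) 1, (jump f x).natAbs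

section HasJump

variable {f g : ℝ → ℤ} {x : ℝ} {d e : ℤ}

lemma hasJump_zero_iff : HasJump f x 0 ↔ ∀ᶠ y in 𝓝 x, f y = f x := by
  rw [HasJump, sub_zero, ← eventually_sup, nhdsLT_sup_nhdsGT, eventually_nhdsWithin_iff]
  refine eventually_congr (Eventually.of_forall fun y => ⟨fun h => ?_, fun h _ => h⟩)
  by_cases hyx : y = x
  · rw [hyx]
  · exact h hyx

lemma eq_of_forall_hasJump_zero (h : ∀ x, HasJump f x 0) (s t : ℝ) : f s = f t :=
  ((IsLocallyConstant.iff_eventually_eq f).2 fun x =>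
    hasJump_zero_iff.1 (h x)).apply_eq_of_preconnectedSpace s t

lemma eventually_hasJump_zero_of_eventually_eq {U : Set ℝ} (hU : IsOpen U) {c : ℤ}
    (h : ∀ᶠ y in 𝓝[U] x, f y = c) : ∀ᶠ y in 𝓝[U] x, HasJump f y 0 := by
  filter_upwards [h, eventually_eventually_nhdsWithin.2 h, self_mem_nhdsWithin] with y hy hev hyU
  rw [hU.nhdsWithin_eq hyU] at hev
  rwa [hasJump_zero_iff, hy]

namespace HasJump

lemma jump_eq (h : HasJump f x d) : jump f x = d := by
  have hlim : Tendsto f (𝓝[<] x) (𝓝 (f x - d)) :=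
    tendsto_const_nhds.congr' (EventuallyEq.symm h.1)
  rw [jump, leftLim_eq_of_tendsto hlim, sub_sub_cancel]

lemma eventually_zero (h : HasJump f x d) : ∀ᶠ y in 𝓝[≠] x, HasJump f y 0 := by
  rw [← nhdsLT_sup_nhdsGT, eventually_sup]
  exact ⟨eventually_hasJump_zero_of_eventually_eq isOpen_Iio h.1,
    eventually_hasJump_zero_of_eventually_eq isOpen_Ioi h.2⟩

lemma const (c : ℤ) (x : ℝ) : HasJump (fun _ => c) x 0 := hasJump_zero_iff.2 (by simp)

lemma map (φ : ℤ → ℤ) (h : HasJump f x d) :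
    HasJump (fun t => φ (f t)) x (φ (f x) - φ (f x - d)) := by
  constructor
  · filter_upwards [h.1] with y hy
    rw [hy, sub_sub_cancel]
  · filter_upwards [h.2] with y hy
    rw [hy]

lemma const_mul (c : ℤ) (h : HasJump f x d) : HasJump (fun t => c * f t) x (c * d) := by
  simpa [mul_sub] using h.map (c * ·)

lemma add (hf : HasJump f x d) (hg : HasJump g x e) :
    HasJump (fun t => f t + g t) x (d + e) := by
  constructor
  · filter_upwards [hf.1, hg.1] with y hfy hgy
    rw [hfy, hgy]; ring
  · filter_upwards [hf.2, hg.2] with y hfy hgy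
    rw [hfy, hgy]

lemma sum {ι : Type*} (X : Finset ι) {f : ι → ℝ → ℤ} {d : ι → ℤ}
    (h : ∀ i ∈ X, HasJump (f i) x (d i)) :
    HasJump (fun t => ∑ i ∈ X, f i t) x (∑ i ∈ X, d i) := by
  classical
  induction X using Finset.induction_on with
  | empty => simpa using const 0 x
  | insert a X ha ih =>
    simp only [Finset.sum_insert ha]
    exact (h a (Finset.mem_insert_self a X)).add
      (ih fun i hi => h i (Finset.mem_insert_of_mem hi))

lemma comp_add_const (a : ℝ) (h : HasJump f (x + a) d) : HasJump (fun t => f (t + a)) x d := by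
  have hcont : Continuous fun t : ℝ => t + a := by fun_prop
  exact ⟨(hcont.continuousWithinAt.tendsto_nhdsWithin fun t (ht : t < x) =>
      add_lt_add_left ht a).eventually h.1,
    (hcont.continuousWithinAt.tendsto_nhdsWithin fun t (ht : x < t) =>
      add_lt_add_left ht a).eventually h.2⟩

lemma floor (x : ℝ) : HasJump (fun t => ⌊t⌋) x (if Int.fract x = 0 then 1 else 0) := by
  have hjump : (if Int.fract x = 0 then 1 else 0) = ⌊x⌋ - (⌈x⌉ - 1) := by
    split_ifs with h
    · obtain ⟨k, rfl⟩ := Int.fract_eq_zero_iff.1 h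
      simp
    · rw [(Int.ceil_eq_floor_add_one_iff_notMem x).2 (mt Int.fract_eq_zero_iff.2 h)]
      ring
  rw [hjump, HasJump, sub_sub_cancel]
  exact ⟨tendsto_pure.1 (tendsto_floor_left_pure_ceil_sub_one x),
    tendsto_pure.1 ((tendsto_floor_right_pure_floor x).mono_left
      (nhdsWithin_mono x Set.Ioi_subset_Ici_self))⟩

end HasJump

end HasJump

namespace IsStep

variable {f : ℝ → ℤ}

lemma hasJump (hf : IsStep f) (x : ℝ) : HasJump f x (jump f x) := by
  obtain ⟨d, hd⟩ := hf.exists_hasJump x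
  rwa [hd.jump_eq]

lemma map (hf : IsStep f) (φ : ℤ → ℤ) : IsStep fun t => φ (f t) :=
  ⟨hf.periodic.comp φ, fun x => ⟨_, (hf.hasJump x).map φ⟩⟩

lemma jump_fract (hf : IsStep f) (x : ℝ) : jump f (Int.fract x) = jump f x := by
  have hshift : (fun t => f (t + ⌊x⌋)) = f :=
    funext fun t => by simpa using hf.periodic.int_mul ⌊x⌋ t
  have h := HasJump.comp_add_const (x := Int.fract x) ⌊x⌋
    (by rw [Int.fract_add_floor]; exact hf.hasJump x)
  rw [hshift] at h
  exact h.jump_eq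

lemma finite_jumps (hf : IsStep f) : {x ∈ Set.Ico (0 : ℝ) 1 | jump f x ≠ 0}.Finite := by
  by_contra hinf
  obtain ⟨x, -, hx⟩ := Set.Infinite.exists_accPt_of_subset_isCompact hinf
    (isCompact_Icc (a := (0 : ℝ)) (b := 1)) fun x hx => Set.Ico_subset_Icc_self hx.1
  rw [accPt_iff_frequently_nhdsNE] at hx
  refine hx ?_
  filter_upwards [(hf.hasJump x).eventually_zero] with y hy hy'
  exact hy'.2 hy.jump_eq

/-- The jump points of a step function in `[0, 1)`. -/
noncomputable def jumps (hf : IsStep f) : Finset ℝ := hf.finite_jumps.toFinset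

lemma mem_jumps (hf : IsStep f) {x : ℝ} :
    x ∈ hf.jumps ↔ x ∈ Set.Ico (0 : ℝ) 1 ∧ jump f x ≠ 0 := by
  simp [jumps]

end IsStep

lemma totalJump_eq_sum {f : ℝ → ℤ} (Y : Finset ℝ) (hY : ∀ y ∈ Y, y ∈ Set.Ico (0 : ℝ) 1)
    (h : ∀ x ∈ Set.Ico (0 : ℝ) 1, jump f x ≠ 0 → x ∈ Y) :
    totalJump f = ∑ x ∈ Y, (jump f x).natAbs := by
  refine finsum_mem_eq_sum_of_inter_support_eq _ ?_
  ext x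
  simp only [Set.mem_inter_iff, Function.mem_support, Finset.mem_coe, ne_eq, Int.natAbs_eq_zero]
  exact ⟨fun ⟨hx, hne⟩ => ⟨h x hx hne, hne⟩, fun ⟨hx, hne⟩ => ⟨hY x hx, hne⟩⟩

lemma IsStep.totalJump_eq {f : ℝ → ℤ} (hf : IsStep f) :
    totalJump f = ∑ x ∈ hf.jumps, (jump f x).natAbs :=
  totalJump_eq_sum _ (fun _ hy => (hf.mem_jumps.1 hy).1) fun _ hx h => hf.mem_jumps.2 ⟨hx, h⟩

/-- An integer combination of translated floor functions. Up to the choice of the weights these are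
the step functions, and `fiberSum` acts on them by multiplying the positions by `N`. -/
noncomputable def staircase {ι : Type*} (X : Finset ι) (w : ι → ℤ) (p : ι → ℝ) (c : ℤ) (t : ℝ) :
    ℤ :=
  c + ∑ x ∈ X, w x * ⌊t - p x⌋

lemma fract_sub_eq_zero_iff {y q : ℝ} (hy : y ∈ Set.Ico (0 : ℝ) 1) :
    Int.fract (y - q) = 0 ↔ y = Int.fract q := by
  rw [← Int.fract_eq_self.2 hy, Int.fract_eq_fract, Int.fract_eq_zero_iff, Set.mem_range]
  simp only [Int.fract_eq_self.2 hy, eq_comm]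

lemma fract_sub_eq_zero_comm (x y : ℝ) : Int.fract (x - y) = 0 ↔ Int.fract (y - x) = 0 := by
  simp only [Int.fract_eq_zero_iff, ← neg_sub y x, Set.mem_range]
  constructor <;> rintro ⟨k, hk⟩ <;> exact ⟨-k, by push_cast; linarith⟩

section staircase

variable {ι : Type*} (X : Finset ι) (w : ι → ℤ) (p : ι → ℝ) (c : ℤ)

lemma hasJump_staircase (y : ℝ) : HasJump (staircase X w p c) y
    (∑ x ∈ X, w x * (if Int.fract (y - p x) = 0 then 1 else 0)) := by
  have hfloor : ∀ x, HasJump (fun t => ⌊t - p x⌋) y (if Int.fract (y - p x) = 0 then 1 else 0) :=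
    fun x => by simpa only [sub_eq_add_neg] using (HasJump.floor (y + -p x)).comp_add_const (-p x)
  have h := (HasJump.const c y).add (HasJump.sum X fun x _ => (hfloor x).const_mul (w x))
  rwa [zero_add] at h

lemma jump_staircase {y : ℝ} (hy : y ∈ Set.Ico (0 : ℝ) 1) : jump (staircase X w p c) y =
    ∑ x ∈ X, if y = Int.fract (p x) then w x else 0 := by
  simp only [(hasJump_staircase X w p c y).jump_eq, fract_sub_eq_zero_iff hy, mul_ite, mul_one,
    mul_zero]

lemma staircase_add_one (t : ℝ) :
    staircase X w p c (t + 1) = staircase X w p c t + ∑ x ∈ X, w x := by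
  simp only [staircase, add_sub_right_comm, Int.floor_add_one, mul_add, mul_one,
    Finset.sum_add_distrib, add_assoc]

lemma isStep_staircase (hw : ∑ x ∈ X, w x = 0) : IsStep (staircase X w p c) :=
  ⟨fun t => by rw [staircase_add_one, hw, add_zero], fun x => ⟨_, hasJump_staircase X w p c x⟩⟩

lemma totalJump_staircase_le : totalJump (staircase X w p c) ≤ ∑ x ∈ X, (w x).natAbs := by
  classical
  set Y : Finset ℝ := X.image fun x => Int.fract (p x)
  have hY : ∀ y ∈ Y, y ∈ Set.Ico (0 : ℝ) 1 := by
    intro y hy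
    obtain ⟨x, -, rfl⟩ := Finset.mem_image.1 hy
    exact ⟨Int.fract_nonneg _, Int.fract_lt_one _⟩
  rw [totalJump_eq_sum Y hY fun y hy hne => ?_]
  · calc ∑ y ∈ Y, (jump (staircase X w p c) y).natAbs
        ≤ ∑ y ∈ Y, ∑ x ∈ X, (if y = Int.fract (p x) then (w x).natAbs else 0) := by
          refine Finset.sum_le_sum fun y hy => ?_
          rw [jump_staircase X w p c (hY y hy)]
          refine (Int.natAbs_sum_le _ _).trans (Finset.sum_le_sum fun x _ => ?_)
          split_ifs <;> simp
      _ = ∑ x ∈ X, ∑ y ∈ Y, (if y = Int.fract (p x) then (w x).natAbs else 0) :=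
          Finset.sum_comm
      _ ≤ ∑ x ∈ X, (w x).natAbs := by
          refine Finset.sum_le_sum fun x _ => ?_
          rw [Finset.sum_ite_eq']
          split_ifs <;> simp
  · rw [jump_staircase X w p c hy] at hne
    obtain ⟨x, hx, hxy⟩ := Finset.exists_ne_zero_of_sum_ne_zero hne
    exact Finset.mem_image.2 ⟨x, hx, by by_contra h; exact hxy (if_neg (Ne.symm h))⟩

lemma sum_range_add_ediv {N : ℕ} (hN : 0 < N) (m : ℤ) :
    ∑ j ∈ Finset.range N, (m + j) / (N : ℤ) = m := by
  have hsucc : ∀ m : ℤ, ∑ j ∈ Finset.range N, (m + 1 + j) / (N : ℤ) =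
      ∑ j ∈ Finset.range N, (m + j) / (N : ℤ) + 1 := by
    intro m
    have htop := Finset.sum_range_succ (fun j : ℕ => (m + j) / (N : ℤ)) N
    rw [Finset.sum_range_succ', Int.add_ediv_of_dvd_right (dvd_refl _),
      Int.ediv_self (by omega)] at htop
    simp only [Nat.cast_zero, add_zero, Nat.cast_succ, add_comm (_ : ℤ) 1, ← add_assoc] at htop ⊢
    linarith
  induction m using Int.induction_on with
  | zero =>
    refine Finset.sum_eq_zero fun j hj => ?_
    rw [zero_add]
    exact Int.ediv_eq_zero_of_lt (by omega) (by exact_mod_cast Finset.mem_range.1 hj)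
  | succ i ih => rw [hsucc, ih]
  | pred i ih =>
    have := hsucc (-(i : ℤ) - 1)
    rw [sub_add_cancel, ih] at this
    omega

lemma fiberSum_floor_sub {N : ℕ} (hN : 0 < N) (x t : ℝ) :
    fiberSum N (fun s => ⌊s - x⌋) t = ⌊t - N * x⌋ := by
  rw [fiberSum, ← sum_range_add_ediv hN ⌊t - N * x⌋]
  refine Finset.sum_congr rfl fun j _ => ?_
  rw [show (t + j) / N - x = (t - N * x + j) / N by field_simp; ring, Int.floor_div_natCast,
    Int.floor_add_natCast]

lemma fiberSum_staircase {N : ℕ} (hN : 0 < N) :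
    fiberSum N (staircase X w p c) = staircase X w (fun x => N * p x) (N * c) := by
  ext t
  simp only [staircase, ← fiberSum_floor_sub hN, fiberSum, Finset.mul_sum, Finset.sum_add_distrib,
    Finset.sum_const, Finset.card_range, nsmul_eq_mul]
  rw [Finset.sum_comm]

end staircase

namespace IsStep

variable {f F : ℝ → ℤ}

theorem eq_staircase (hf : IsStep f) : ∃ c, f = staircase hf.jumps (jump f) id c := by
  have hjump : ∀ y, HasJump (staircase hf.jumps (jump f) id 0) y (jump f y) := by
    intro y
    have hy : Int.fract y ∈ Set.Ico (0 : ℝ) 1 := ⟨Int.fract_nonneg y, Int.fract_lt_one y⟩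
    convert hasJump_staircase hf.jumps (jump f) id 0 y using 1
    calc jump f y = ∑ x ∈ hf.jumps, if x = Int.fract y then jump f x else 0 := by
          rw [Finset.sum_ite_eq', ← hf.jump_fract y, eq_comm, ite_eq_left_iff]
          exact fun h => not_not.1 fun h0 => h (hf.mem_jumps.2 ⟨hy, Ne.symm h0⟩)
      _ = _ := Finset.sum_congr rfl fun x hx => by
          simp only [id, mul_ite, mul_one, mul_zero, ← fract_sub_eq_zero_iff (hf.mem_jumps.1 hx).1,
            fract_sub_eq_zero_comm x y]
  have hdiff : ∀ y, HasJump (fun t => f t + -1 * staircase hf.jumps (jump f) id 0 t) y 0 :=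
    fun y => by simpa using (hf.hasJump y).add ((hjump y).const_mul (-1))
  refine ⟨f 0 + -1 * staircase hf.jumps (jump f) id 0 0, funext fun t => ?_⟩
  have := eq_of_forall_hasJump_zero hdiff t 0
  simp only [staircase] at this ⊢
  linarith

lemma sum_jump (hf : IsStep f) : ∑ x ∈ hf.jumps, jump f x = 0 := by
  obtain ⟨c, hc⟩ := hf.eq_staircase
  have hperiod := hf.periodic 0
  have hadd := staircase_add_one hf.jumps (jump f) id c 0
  rw [← hc] at hadd
  omega

lemma measurable (hf : IsStep f) : Measurable f := by
  obtain ⟨c, hc⟩ := hf.eq_staircase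
  rw [hc]
  exact measurable_const.add (Finset.measurable_sum _ fun x _ =>
    (Int.measurable_floor.comp (measurable_id.sub_const _)).const_mul _)

lemma fiberSum (hf : IsStep f) {N : ℕ} (hN : 0 < N) : IsStep (fiberSum N f) := by
  obtain ⟨c, hc⟩ := hf.eq_staircase
  rw [hc, fiberSum_staircase _ _ _ _ hN]
  exact isStep_staircase _ _ _ _ hf.sum_jump

lemma totalJump_fiberSum_le (hf : IsStep f) {N : ℕ} (hN : 0 < N) :
    totalJump (_root_.fiberSum N f) ≤ totalJump f := by
  obtain ⟨c, hc⟩ := hf.eq_staircase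
  rw [hf.totalJump_eq]
  conv_lhs => rw [hc, fiberSum_staircase _ _ _ _ hN]
  exact totalJump_staircase_le _ _ _ _

lemma superlevel (hF : IsStep F) (n : ℕ) : IsStep (superlevel n F) :=
  hF.map fun v => if (n : ℤ) < v then 1 else 0

lemma jump_superlevel (hF : IsStep F) (n : ℕ) (x : ℝ) : jump (_root_.superlevel n F) x =
    (if (n : ℤ) < F x then 1 else 0) - if (n : ℤ) < F x - jump F x then 1 else 0 :=
  ((hF.hasJump x).map fun v => if (n : ℤ) < v then 1 else 0).jump_eq

lemma totalJump_superlevel_add_le (hF : IsStep F) {n m : ℕ} (hnm : n ≠ m) :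
    totalJump (_root_.superlevel n F) + totalJump (_root_.superlevel m F) ≤ totalJump F := by
  have hsub : ∀ k, ∀ x ∈ Set.Ico (0 : ℝ) 1, jump (_root_.superlevel k F) x ≠ 0 →
      x ∈ hF.jumps := by
    intro k x hx h
    refine hF.mem_jumps.2 ⟨hx, fun h0 => h ?_⟩
    rw [hF.jump_superlevel, h0, sub_zero, sub_self]
  have hmem : ∀ y ∈ hF.jumps, y ∈ Set.Ico (0 : ℝ) 1 := fun y hy => (hF.mem_jumps.1 hy).1
  rw [hF.totalJump_eq, totalJump_eq_sum _ hmem (hsub n), totalJump_eq_sum _ hmem (hsub m),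
    ← Finset.sum_add_distrib]
  refine Finset.sum_le_sum fun x _ => ?_
  rw [hF.jump_superlevel, hF.jump_superlevel]
  split_ifs <;> omega

lemma totalJump_superlevel_le (hF : IsStep F) (n : ℕ) :
    totalJump (_root_.superlevel n F) ≤ totalJump F :=
  (Nat.le_add_right _ _).trans (hF.totalJump_superlevel_add_le n.succ_ne_self.symm)

lemma eq_const_of_totalJump_eq_zero (hf : IsStep f) (h : totalJump f = 0) :
    ∃ c, ∀ t, f t = c := by
  obtain ⟨c, hc⟩ := hf.eq_staircase
  rw [hf.totalJump_eq, Finset.sum_eq_zero_iff] at h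
  refine ⟨c, fun t => ?_⟩
  rw [hc, staircase, Finset.sum_eq_zero, add_zero]
  intro x hx
  rw [Int.natAbs_eq_zero.1 (h x hx), zero_mul]

end IsStep

/-! ### Fourier coefficients of functions of period one -/

/-- The exponential `e(-n t)`, against which the `n`-th Fourier coefficient is taken. -/
noncomputable def conjExp (n : ℤ) (t : ℝ) : ℂ :=
  Complex.exp (-(2 * Real.pi * Complex.I * n * t))

section conjExp

lemma fourier_neg_coe {T : ℝ} (hT : T = 1) (n : ℤ) (t : ℝ) :
    fourier (-n) (t : AddCircle T) = conjExp n t := by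
  rw [fourier_coe_apply, conjExp, hT]
  push_cast
  ring_nf

lemma conjExp_add_int (n : ℤ) (t : ℝ) (k : ℤ) : conjExp n (t + k) = conjExp n t := by
  rw [conjExp, conjExp, Complex.exp_eq_exp_iff_exists_int]
  exact ⟨-(n * k), by push_cast; ring⟩

lemma conjExp_add (n : ℤ) (s t : ℝ) : conjExp n (s + t) = conjExp n s * conjExp n t := by
  simp only [conjExp, ← Complex.exp_add]
  push_cast
  ring_nf

lemma conjExp_index_add (m n : ℤ) (t : ℝ) : conjExp (m + n) t = conjExp m t * conjExp n t := by
  simp only [conjExp, ← Complex.exp_add]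
  push_cast
  ring_nf

lemma conjExp_natCast_mul (N : ℕ) (n : ℤ) (t : ℝ) : conjExp (N * n) t = conjExp n (N * t) := by
  simp only [conjExp]
  push_cast
  ring_nf

lemma conjExp_natCast (n : ℕ) (t : ℝ) : conjExp n t = conjExp 1 t ^ n := by
  simp only [conjExp, ← Complex.exp_nat_mul]
  push_cast
  ring_nf

@[simp]
lemma norm_conjExp (n : ℤ) (t : ℝ) : ‖conjExp n t‖ = 1 := by
  rw [← fourier_neg_coe rfl, fourier_apply, Circle.norm_coe]

lemma conjExp_ne_zero (n : ℤ) (t : ℝ) : conjExp n t ≠ 0 := Complex.exp_ne_zero _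

lemma continuous_conjExp (n : ℤ) : Continuous (conjExp n) := by unfold conjExp; fun_prop

lemma measurable_conjExp (n : ℤ) : Measurable (conjExp n) := (continuous_conjExp n).measurable

lemma periodic_conjExp (n : ℤ) : Function.Periodic (conjExp n) 1 := fun t => by
  simpa using conjExp_add_int n t 1

end conjExp

/-- Measurable functions of period one that are square integrable over a period. Functions are
used in place of classes, since they are evaluated along fibers. -/
structure PeriodicL2 (g : ℝ → ℂ) : Prop where
  measurable : Measurable g
  periodic : Function.Periodic g 1
  integrable_sq : IntervalIntegrable (fun t => ‖g t‖ ^ 2) volume 0 1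

/-- The Fourier coefficients of a function of period one. -/
noncomputable def unitFourierCoeff (g : ℝ → ℂ) (n : ℤ) : ℂ := ∫ t in (0 : ℝ)..1, g t * conjExp n t

namespace PeriodicL2

variable {g h : ℝ → ℂ}

lemma memLp (hg : PeriodicL2 g) : MemLp g 2 (volume.restrict (Set.Ioc (0 : ℝ) 1)) := by
  rw [memLp_two_iff_integrable_sq_norm hg.measurable.aestronglyMeasurable]
  exact (intervalIntegrable_iff_integrableOn_Ioc_of_le zero_le_one).1 hg.integrable_sq

lemma of_memLp (hm : Measurable g) (hp : Function.Periodic g 1)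
    (h : MemLp g 2 (volume.restrict (Set.Ioc (0 : ℝ) 1))) : PeriodicL2 g := by
  refine ⟨hm, hp, (intervalIntegrable_iff_integrableOn_Ioc_of_le zero_le_one).2 ?_⟩
  exact (memLp_two_iff_integrable_sq_norm hm.aestronglyMeasurable).1 h

lemma zero : PeriodicL2 fun _ => 0 := of_memLp measurable_const (fun _ => rfl) MemLp.zero'

lemma add (hg : PeriodicL2 g) (hh : PeriodicL2 h) : PeriodicL2 fun t => g t + h t :=
  of_memLp (hg.measurable.add hh.measurable) (hg.periodic.add hh.periodic) (hg.memLp.add hh.memLp)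

lemma sub (hg : PeriodicL2 g) (hh : PeriodicL2 h) : PeriodicL2 fun t => g t - h t :=
  of_memLp (hg.measurable.sub hh.measurable) (hg.periodic.sub hh.periodic) (hg.memLp.sub hh.memLp)

lemma bdd_mul {φ : ℝ → ℂ} (hg : PeriodicL2 g) (hφ : Measurable φ) (hp : Function.Periodic φ 1)
    (C : ℝ) (hC : ∀ t, ‖φ t‖ ≤ C) : PeriodicL2 fun t => φ t * g t := by
  refine of_memLp (hφ.mul hg.measurable) (hp.mul hg.periodic) ?_
  refine hg.memLp.of_le_mul (c := C) (hφ.mul hg.measurable).aestronglyMeasurable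
    (Eventually.of_forall fun t => ?_)
  rw [norm_mul]
  exact mul_le_mul_of_nonneg_right (hC t) (norm_nonneg _)

lemma intervalIntegrable_sq (hg : PeriodicL2 g) (a b : ℝ) :
    IntervalIntegrable (fun t => ‖g t‖ ^ 2) volume a b :=
  (hg.periodic.comp fun z => ‖z‖ ^ 2).intervalIntegrable₀ one_ne_zero hg.integrable_sq a b

lemma intervalIntegrable (hg : PeriodicL2 g) (a b : ℝ) : IntervalIntegrable g volume a b :=
  hg.periodic.intervalIntegrable₀ one_ne_zero
    ((intervalIntegrable_iff_integrableOn_Ioc_of_le zero_le_one).2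
      (hg.memLp.integrable one_le_two)) a b

lemma mul_conjExp (hg : PeriodicL2 g) (n : ℤ) : PeriodicL2 fun t => g t * conjExp n t := by
  simp only [mul_comm (g _)]
  exact hg.bdd_mul (measurable_conjExp n) (periodic_conjExp n) 1 fun t => (norm_conjExp n t).le

lemma unitFourierCoeff_add (hg : PeriodicL2 g) (hh : PeriodicL2 h) (n : ℤ) :
    unitFourierCoeff (fun t => g t + h t) n = unitFourierCoeff g n + unitFourierCoeff h n := by
  unfold unitFourierCoeff
  rw [← intervalIntegral.integral_add ((hg.mul_conjExp n).intervalIntegrable 0 1)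
    ((hh.mul_conjExp n).intervalIntegrable 0 1)]
  simp only [add_mul]

lemma unitFourierCoeff_sub (hg : PeriodicL2 g) (hh : PeriodicL2 h) (n : ℤ) :
    unitFourierCoeff (fun t => g t - h t) n = unitFourierCoeff g n - unitFourierCoeff h n := by
  unfold unitFourierCoeff
  rw [← intervalIntegral.integral_sub ((hg.mul_conjExp n).intervalIntegrable 0 1)
    ((hh.mul_conjExp n).intervalIntegrable 0 1)]
  simp only [sub_mul]

end PeriodicL2

lemma fourierCoeffOn_eq_unitFourierCoeff (g : ℝ → ℂ) (n : ℤ) :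
    fourierCoeffOn zero_lt_one g n = unitFourierCoeff g n := by
  rw [fourierCoeffOn_eq_integral, unitFourierCoeff]
  simp only [fourier_neg_coe (sub_zero (1 : ℝ)), sub_zero, div_one, one_smul, smul_eq_mul, mul_comm]

lemma hasSum_sq_unitFourierCoeff {g : ℝ → ℂ}
    (hg : MemLp g 2 (volume.restrict (Set.Ioc (0 : ℝ) 1))) :
    HasSum (fun n => ‖unitFourierCoeff g n‖ ^ 2) (∫ t in (0 : ℝ)..1, ‖g t‖ ^ 2) := by
  simpa [fourierCoeffOn_eq_unitFourierCoeff] using hasSum_sq_fourierCoeffOn zero_lt_one hg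

lemma PeriodicL2.summable_sq_unitFourierCoeff {g : ℝ → ℂ} (hg : PeriodicL2 g) :
    Summable fun n => ‖unitFourierCoeff g n‖ ^ 2 :=
  (hasSum_sq_unitFourierCoeff hg.memLp).summable

lemma ae_of_ae_restrict_Ioc {P : ℝ → Prop} (hP : Function.Periodic P 1)
    (h : ∀ᵐ t ∂volume.restrict (Set.Ioc (0 : ℝ) 1), P t) : ∀ᵐ t, P t := by
  rw [ae_restrict_iff' measurableSet_Ioc] at h
  have htranslate : ∀ k : ℤ, ∀ᵐ t, t - (k : ℝ) ∈ Set.Ioc (0 : ℝ) 1 → P (t - k) := fun k =>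
    (measurePreserving_sub_right volume (k : ℝ)).quasiMeasurePreserving.ae h
  filter_upwards [ae_all_iff.2 htranslate] with t ht
  have hshift : P (t - (⌈t⌉ - 1 : ℤ)) = P t := by simpa using hP.sub_int_mul_eq (⌈t⌉ - 1) (x := t)
  rw [← hshift]
  refine ht _ ?_
  push_cast
  constructor <;> linarith [Int.ceil_lt_add_one t, Int.le_ceil t]

lemma PeriodicL2.ae_eq_zero {g : ℝ → ℂ} (hg : PeriodicL2 g) (h : ∀ n, unitFourierCoeff g n = 0) :
    ∀ᵐ t, g t = 0 := by
  refine ae_of_ae_restrict_Ioc (hg.periodic.comp (· = 0)) ?_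
  have hparseval := hasSum_sq_unitFourierCoeff hg.memLp
  simp only [h, norm_zero, ne_eq, OfNat.ofNat_ne_zero, not_false_eq_true, zero_pow] at hparseval
  have hint := hparseval.unique hasSum_zero
  rw [intervalIntegral.integral_of_le zero_le_one, integral_eq_zero_iff_of_nonneg
    (fun t => by positivity) ((intervalIntegrable_iff_integrableOn_Ioc_of_le zero_le_one).1
      hg.integrable_sq)] at hint
  filter_upwards [hint] with t ht
  simpa using ht

theorem exists_periodicL2_unitFourierCoeff_eq (c : lp (fun _ : ℤ => ℂ) 2) :
    ∃ g, PeriodicL2 g ∧ ∀ n, unitFourierCoeff g n = c n := by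
  have : Fact ((0 : ℝ) < 1) := ⟨zero_lt_one⟩
  set x : Lp ℂ 2 (@AddCircle.haarAddCircle 1 _) := fourierBasis.repr.symm c with hx
  have hmk := AddCircle.measurePreserving_mk 1 (0 : ℝ)
  rw [zero_add] at hmk
  have hLp : MemLp (fun t : ℝ => x (t : AddCircle (1 : ℝ))) 2
      (volume.restrict (Set.Ioc (0 : ℝ) 1)) :=
    (memLp_haarAddCircle_iff.1 (Lp.memLp x)).comp_measurePreserving hmk
  refine ⟨fun t => x (t : AddCircle (1 : ℝ)), PeriodicL2.of_memLp
    ((Lp.stronglyMeasurable x).measurable.comp AddCircle.measurable_mk') (fun t => ?_) hLp,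
    fun n => ?_⟩
  · simp only [AddCircle.coe_add, AddCircle.coe_period, add_zero]
  · have hcoeff := fourierBasis_repr x n
    rw [hx, LinearIsometryEquiv.apply_symm_apply, ← hx,
      fourierCoeff_eq_intervalIntegral _ n 0] at hcoeff
    rw [hcoeff, unitFourierCoeff]
    simp only [zero_add, div_one, one_smul, fourier_neg_coe rfl, smul_eq_mul, mul_comm]

/-- For the indicator `f` (of period one) of a set `S` of the circle: the exponentials with
frequencies in `Λ` form a Riesz basis of `L²(S)`, in the form that taking Fourier coefficients on
`Λ` is a bijection from the square integrable functions supported on `S` onto `ℓ²(Λ)`. Surjectivity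
is phrased through the coefficients of square integrable functions, which are all of `ℓ²` by
`exists_periodicL2_unitFourierCoeff_eq`. -/
structure IsRieszSpectrum (f : ℝ → ℤ) (Λ : Set ℤ) : Prop where
  ae_eq_zero : ∀ g, PeriodicL2 g → (∀ t, f t = 0 → g t = 0) →
    (∀ n ∈ Λ, unitFourierCoeff g n = 0) → ∀ᵐ t, g t = 0
  exists_eq : ∀ h, PeriodicL2 h → ∃ g, PeriodicL2 g ∧ (∀ t, f t = 0 → g t = 0) ∧
    ∀ n ∈ Λ, unitFourierCoeff g n = unitFourierCoeff h n

/-! ### Combining spectra along the fibers of multiplication by `N` -/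

section Vandermonde

variable {ι : Type*} {s : Finset ι} {n : ℕ}

lemma eq_zero_of_forall_sum_pow_mul_eq_zero {R : Type*} [CommRing R] [IsDomain R] {v x : ι → R}
    (hv : Set.InjOn v s) (hn : s.card ≤ n) (h : ∀ i < n, ∑ j ∈ s, v j ^ i * x j = 0) :
    ∀ j ∈ s, x j = 0 := by
  have hinj : Function.Injective fun a => v (s.equivFin.symm a) := fun a b hab =>
    s.equivFin.symm.injective (Subtype.ext (hv (s.equivFin.symm a).2 (s.equivFin.symm b).2 hab))
  have hzero := Matrix.eq_zero_of_forall_pow_sum_mul_pow_eq_zero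
    (v := fun a => x (s.equivFin.symm a)) hinj fun i => by
      rw [← h i (i.2.trans_le hn), ← Finset.sum_coe_sort s]
      simpa only [mul_comm] using s.equivFin.symm.sum_comp fun j : s => v j ^ (i : ℕ) * x j
  intro j hj
  simpa using congrFun hzero (s.equivFin ⟨j, hj⟩)

/-- Lagrange interpolation of `X ^ (i + s.card - 1 - n)` at the nodes `v j`: the sum is its
coefficient of degree `s.card - 1`. -/
lemma sum_pow_mul_pow_div_prod_sub {F : Type*} [Field F] [DecidableEq ι] {v : ι → F}
    (hv : Set.InjOn v s) (hn : n < s.card) {i : ℕ} (hi : i ≤ n) :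
    ∑ j ∈ s, v j ^ i * (v j ^ (s.card - 1 - n) / ∏ k ∈ s.erase j, (v j - v k)) =
      if i = n then 1 else 0 := by
  have h := Lagrange.coeff_eq_sum (P := (Polynomial.X : Polynomial F) ^ (i + (s.card - 1 - n))) hv
    (by rw [Polynomial.degree_X_pow, Nat.cast_lt]; omega)
  rw [Polynomial.coeff_X_pow] at h
  simp only [Polynomial.eval_pow, Polynomial.eval_X, Polynomial.eval_mul, pow_add,
    mul_div_assoc] at h
  rw [← h]
  exact if_congr (by omega) rfl rfl

end Vandermonde

lemma conjExp_one_eq_iff {s t : ℝ} : conjExp 1 s = conjExp 1 t ↔ ∃ k : ℤ, s = t + k := by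
  simp only [conjExp, Complex.exp_eq_exp_iff_exists_int]
  have hpi : (2 * Real.pi * Complex.I : ℂ) ≠ 0 := Complex.two_pi_I_ne_zero
  constructor
  · rintro ⟨k, hk⟩
    have hst : (s : ℂ) = t - k := mul_left_cancel₀ hpi (by push_cast at hk; linear_combination -hk)
    exact ⟨-k, by push_cast; rw [← sub_eq_add_neg]; exact_mod_cast hst⟩
  · rintro ⟨k, rfl⟩
    exact ⟨-k, by push_cast; ring⟩

lemma injOn_conjExp_one_fiber (N : ℕ) (t : ℝ) :
    Set.InjOn (fun j : ℕ => conjExp 1 ((t + j) / N)) (Finset.range N) := by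
  intro a ha b hb hab
  simp only [Finset.coe_range, Set.mem_Iio] at ha hb
  obtain ⟨k, hk⟩ := conjExp_one_eq_iff.1 hab
  have hN : (N : ℝ) ≠ 0 := by
    have : 0 < N := by omega
    positivity
  field_simp at hk
  have hab' : (a : ℤ) = b + N * k := by
    have : (a : ℝ) = b + N * k := by linarith
    exact_mod_cast this
  have hk0 : k = 0 := by
    by_contra hk0
    rcases lt_or_gt_of_ne hk0 with h | h <;> nlinarith
  rw [hk0] at hab'
  omega

/-- The sum of `g(s) e(-n s)` over the fiber above `t` of multiplication by `N`. It collects the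
Fourier coefficients of `g` in the residue class of `n` modulo `N`. -/
noncomputable def twistedFiberSum (N : ℕ) (n : ℤ) (g : ℝ → ℂ) : ℝ → ℂ :=
  fiberSum N fun s => g s * conjExp n s

lemma intervalIntegrable_comp_div_add {E : Type*} [NormedAddCommGroup E] {q : ℝ → E}
    (hq : ∀ a b, IntervalIntegrable q volume a b) {N : ℝ} (hN : N ≠ 0) (d a b : ℝ) :
    IntervalIntegrable (fun t => q ((t + d) / N)) volume a b := by
  convert ((hq ((a + d) / N) ((b + d) / N)).comp_mul_left (c := N⁻¹)).comp_add_right d using 1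
  · ext t; congr 1; field_simp
  · field_simp; ring
  · field_simp; ring

lemma intervalIntegral_fiberSum {E : Type*} [NormedAddCommGroup E] [NormedSpace ℝ E] {q : ℝ → E}
    (hq : ∀ a b, IntervalIntegrable q volume a b) {N : ℕ} (hN : 0 < N) :
    ∫ t in (0 : ℝ)..1, fiberSum N q t = (N : ℝ) • ∫ s in (0 : ℝ)..1, q s := by
  have hN' : (N : ℝ) ≠ 0 := by positivity
  have hpiece : ∀ j ∈ Finset.range N, ∫ t in (0 : ℝ)..1, q ((t + j) / N) =
      (N : ℝ) • ∫ s in ((j : ℕ) / N : ℝ)..((j + 1 : ℕ) / N : ℝ), q s := by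
    intro j _
    simp only [add_div]
    rw [intervalIntegral.integral_comp_div_add q hN', zero_div, zero_add, ← add_div, add_comm,
      Nat.cast_succ]
  simp only [fiberSum]
  rw [intervalIntegral.integral_finsetSum (f := fun (j : ℕ) t => q ((t + j) / N))
      fun j _ => intervalIntegrable_comp_div_add hq hN' j 0 1,
    Finset.sum_congr rfl hpiece, ← Finset.smul_sum,
    intervalIntegral.sum_integral_adjacent_intervals (a := fun j : ℕ => (j : ℝ) / N)
      fun j _ => hq _ _]
  simp [div_self hN']

lemma PeriodicL2.twistedFiberSum {g : ℝ → ℂ} (hg : PeriodicL2 g) {N : ℕ} (hN : 0 < N) (n : ℤ) :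
    PeriodicL2 (twistedFiberSum N n g) := by
  have hmeas : ∀ j : ℕ, Measurable fun t : ℝ => g ((t + j) / N) * conjExp n ((t + j) / N) :=
    fun j => (hg.mul_conjExp n).measurable.comp ((measurable_id.add_const _).div_const _)
  have hterm : ∀ j ∈ Finset.range N, MemLp (fun t : ℝ => g ((t + j) / N) * conjExp n ((t + j) / N))
      2 (volume.restrict (Set.Ioc 0 1)) := fun j _ => by
    rw [memLp_two_iff_integrable_sq_norm (hmeas j).aestronglyMeasurable]
    exact (intervalIntegrable_iff_integrableOn_Ioc_of_le zero_le_one).1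
      (intervalIntegrable_comp_div_add (hg.mul_conjExp n).intervalIntegrable_sq
        (Nat.cast_ne_zero.2 hN.ne') j 0 1)
  have hsum := memLp_finsetSum _ hterm
  exact PeriodicL2.of_memLp (measurable_fiberSum (hg.mul_conjExp n).measurable N)
    (periodic_fiberSum (hg.mul_conjExp n).periodic N) hsum

lemma unitFourierCoeff_twistedFiberSum {g : ℝ → ℂ} (hg : PeriodicL2 g) {N : ℕ} (hN : 0 < N)
    (n l : ℤ) :
    unitFourierCoeff (twistedFiberSum N n g) l = N * unitFourierCoeff g (N * l + n) := by
  have hmodulate : ∀ t, twistedFiberSum N n g t * conjExp l t =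
      fiberSum N (fun s => g s * conjExp (N * l + n) s) t := by
    intro t
    rw [twistedFiberSum, fiberSum, Finset.sum_mul]
    refine Finset.sum_congr rfl fun j _ => ?_
    have hl : conjExp l t = conjExp (N * l) ((t + j) / N) := by
      rw [conjExp_natCast_mul, mul_div_cancel₀ _ (Nat.cast_ne_zero.2 hN.ne'),
        ← conjExp_add_int l t j, Int.cast_natCast]
    simp only [hl, conjExp_index_add]
    ring
  simp only [unitFourierCoeff, hmodulate,
    intervalIntegral_fiberSum (hg.mul_conjExp (N * l + n)).intervalIntegrable hN,
    Complex.real_smul, Complex.ofReal_natCast]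

/-- The indicators of measurable subsets of the circle `ℝ / ℤ`. -/
structure IsCircleIndicator (f : ℝ → ℤ) : Prop where
  measurable : Measurable f
  periodic : Function.Periodic f 1
  eq_zero_or_one : ∀ t, f t = 0 ∨ f t = 1

/-- The positions of the points of the fiber above `t` at which `f` is one. -/
noncomputable def fiberIndices (N : ℕ) (f : ℝ → ℤ) (t : ℝ) : Finset ℕ :=
  (Finset.range N).filter fun j => f ((t + j) / N) = 1

lemma fiberIndices_subset_range (N : ℕ) (f : ℝ → ℤ) (t : ℝ) :
    fiberIndices N f t ⊆ Finset.range N :=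
  Finset.filter_subset _ _

lemma ae_of_ae_div {P : ℝ → Prop} {N : ℝ} (hN : N ≠ 0) (h : ∀ᵐ t : ℝ, P (t / N)) : ∀ᵐ t, P t := by
  have hquasi : Measure.QuasiMeasurePreserving (fun t : ℝ => N * t) volume volume := by
    refine ⟨measurable_const_mul _, ?_⟩
    rw [Real.map_volume_mul_left hN]
    exact Measure.smul_absolutelyContinuous
  filter_upwards [hquasi.ae h] with t ht
  rwa [mul_div_cancel_left₀ _ hN] at ht

lemma unitFourierCoeff_congr_ae {g h : ℝ → ℂ}
    (H : g =ᵐ[volume.restrict (Set.Ioc (0 : ℝ) 1)] h) (n : ℤ) :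
    unitFourierCoeff g n = unitFourierCoeff h n := by
  rw [unitFourierCoeff, unitFourierCoeff, intervalIntegral.integral_of_le zero_le_one,
    intervalIntegral.integral_of_le zero_le_one]
  exact integral_congr_ae (H.mono fun t ht => by simp only [ht])

namespace IsCircleIndicator

variable {N n : ℕ} {f : ℝ → ℤ} {Λ : ℕ → Set ℤ}

lemma superlevel {F : ℝ → ℤ} (hm : Measurable F) (hp : Function.Periodic F 1) (n : ℕ) :
    IsCircleIndicator (superlevel n F) where
  measurable := measurable_superlevel hm n
  periodic := hp.comp fun v => if (n : ℤ) < v then 1 else 0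
  eq_zero_or_one := superlevel_eq_zero_or_one n F

lemma bdd_mul {g : ℝ → ℂ} (hf : IsCircleIndicator f) (hg : PeriodicL2 g) :
    PeriodicL2 fun t => (f t : ℂ) * g t :=
  hg.bdd_mul ((measurable_from_top (f := fun k : ℤ => (k : ℂ))).comp hf.measurable)
    (hf.periodic.comp _) 1 fun t => by rcases hf.eq_zero_or_one t with h | h <;> simp [h]

lemma fiberSum_eq_card (hf : IsCircleIndicator f) (t : ℝ) :
    fiberSum N f t = (fiberIndices N f t).card := by
  rw [fiberIndices, Finset.card_filter, fiberSum]
  push_cast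
  refine Finset.sum_congr rfl fun j _ => ?_
  rcases hf.eq_zero_or_one ((t + j) / N) with h | h <;> simp [h]

lemma superlevel_fiberSum_eq_zero_iff (hf : IsCircleIndicator f) (t : ℝ) :
    _root_.superlevel n (fiberSum N f) t = 0 ↔ (fiberIndices N f t).card ≤ n := by
  rw [_root_.superlevel, hf.fiberSum_eq_card]
  split_ifs with h
  · simp only [one_ne_zero, false_iff]; omega
  · simp only [true_iff]; omega

lemma eq_zero_of_twistedFiberSum_eq_zero (hf : IsCircleIndicator f) {g : ℝ → ℂ}
    (hs : ∀ t, f t = 0 → g t = 0) {t : ℝ} (hn : (fiberIndices N f t).card ≤ n)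
    (h : ∀ i < n, twistedFiberSum N i g t = 0) : ∀ j < N, g ((t + j) / N) = 0 := by
  have hout : ∀ j ∈ Finset.range N, j ∉ fiberIndices N f t → g ((t + j) / N) = 0 :=
    fun j hj hj' => hs _ ((hf.eq_zero_or_one _).resolve_right fun h1 =>
      hj' (Finset.mem_filter.2 ⟨hj, h1⟩))
  have hin := eq_zero_of_forall_sum_pow_mul_eq_zero (x := fun j : ℕ => g ((t + j) / N))
    ((injOn_conjExp_one_fiber N t).mono (Finset.coe_subset.2 (fiberIndices_subset_range N f t)))
    hn fun i hi => by
      rw [← h i hi, twistedFiberSum, fiberSum,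
        ← Finset.sum_subset (fiberIndices_subset_range N f t)
          fun j hj hj' => by rw [hout j hj hj', zero_mul]]
      exact Finset.sum_congr rfl fun j _ => by rw [conjExp_natCast, mul_comm]
  intro j hj
  by_cases hj' : j ∈ fiberIndices N f t
  · exact hin j hj'
  · exact hout j (Finset.mem_range.2 hj) hj'

lemma ae_twistedFiberSum_eq_zero (hf : IsCircleIndicator f) (hN : 0 < N)
    (H : ∀ n < N, IsRieszSpectrum (_root_.superlevel n (fiberSum N f)) (Λ n))
    {g : ℝ → ℂ} (hg : PeriodicL2 g) (hs : ∀ t, f t = 0 → g t = 0)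
    (h0 : ∀ n < N, ∀ l ∈ Λ n, unitFourierCoeff g (N * l + n) = 0) (hn : n < N) :
    ∀ᵐ t, twistedFiberSum N n g t = 0 := by
  induction n using Nat.strong_induction_on with
  | _ n ih =>
    have hearlier : ∀ᵐ t, ∀ i ∈ Finset.range n, twistedFiberSum N i g t = 0 :=
      (eventually_all_finset _).2 fun i hi =>
        ih i (Finset.mem_range.1 hi) ((Finset.mem_range.1 hi).trans hn)
    have hsupp : ∀ᵐ t, (_root_.superlevel n (fiberSum N f) t : ℂ) * twistedFiberSum N n g t =
        twistedFiberSum N n g t := by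
      filter_upwards [hearlier] with t ht
      rcases superlevel_eq_zero_or_one n (fiberSum N f) t with h | h
      · have hzero := hf.eq_zero_of_twistedFiberSum_eq_zero hs
          ((hf.superlevel_fiberSum_eq_zero_iff t).1 h) fun i hi => ht i (Finset.mem_range.2 hi)
        rw [twistedFiberSum, fiberSum, Finset.sum_eq_zero, mul_zero]
        intro j hj
        rw [hzero j (Finset.mem_range.1 hj), zero_mul]
      · rw [h, Int.cast_one, one_mul]
    have hind := IsCircleIndicator.superlevel (measurable_fiberSum hf.measurable N)
      (periodic_fiberSum hf.periodic N) n
    have hvanish := (H n hn).ae_eq_zero _ (hind.bdd_mul (hg.twistedFiberSum hN n))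
      (fun t ht => by rw [ht, Int.cast_zero, zero_mul]) fun l hl => by
        rw [unitFourierCoeff_congr_ae (ae_restrict_of_ae hsupp),
          unitFourierCoeff_twistedFiberSum hg hN, h0 n hn l hl, mul_zero]
    filter_upwards [hsupp, hvanish] with t heq hzero
    rw [← heq, hzero]

lemma ae_eq_zero_of_fiberSum (hf : IsCircleIndicator f) (hN : 0 < N)
    (H : ∀ n < N, IsRieszSpectrum (_root_.superlevel n (fiberSum N f)) (Λ n))
    {g : ℝ → ℂ} (hg : PeriodicL2 g) (hs : ∀ t, f t = 0 → g t = 0)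
    (h0 : ∀ n < N, ∀ l ∈ Λ n, unitFourierCoeff g (N * l + n) = 0) : ∀ᵐ t, g t = 0 := by
  have hall : ∀ᵐ t, ∀ i ∈ Finset.range N, twistedFiberSum N i g t = 0 :=
    (eventually_all_finset _).2 fun i hi =>
      hf.ae_twistedFiberSum_eq_zero hN H hg hs h0 (Finset.mem_range.1 hi)
  refine ae_of_ae_div (Nat.cast_ne_zero.2 hN.ne') ?_
  filter_upwards [hall] with t ht
  have hcard : (fiberIndices N f t).card ≤ N := by
    simpa using Finset.card_le_card (fiberIndices_subset_range N f t)
  simpa using hf.eq_zero_of_twistedFiberSum_eq_zero hs hcard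
    (fun i hi => ht i (Finset.mem_range.2 hi)) 0 hN

end IsCircleIndicator

/-- The difference of `e(-s)` and `e(-r)` where `f` is one at `r` and the two differ, and one
elsewhere, so that it can be divided by. -/
noncomputable def nodeDifference (f : ℝ → ℤ) (s r : ℝ) : ℂ :=
  if f r = 1 ∧ conjExp 1 r ≠ conjExp 1 s then conjExp 1 s - conjExp 1 r else 1

/-- The weights dual to the powers `i ≤ n` of the points `e(-r)`, where `r` ranges over the points
of the fiber of `s` in the set with indicator `f`; see `sum_pow_mul_pow_div_prod_sub`. The
products are taken over the points `s + k / N`, so that the weights are measurable in `s`. -/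
noncomputable def dualWeight (N n : ℕ) (f : ℝ → ℤ) (s : ℝ) : ℂ :=
  conjExp (fiberSum N f (N * s) - 1 - n) s /
    ∏ k ∈ Finset.range N, nodeDifference f s (s + k / N)

namespace IsCircleIndicator

variable {N : ℕ} {f : ℝ → ℤ}

lemma measurable_dualWeight (hf : IsCircleIndicator f) (n : ℕ) : Measurable (dualWeight N n f) := by
  have hconjExp : Measurable fun p : ℤ × ℝ => conjExp p.1 p.2 :=
    measurable_from_prod_countable_right measurable_conjExp
  have hM : Measurable fun s : ℝ => fiberSum N f (N * s) - 1 - n :=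
    (((measurable_fiberSum hf.measurable N).comp (measurable_const_mul _)).sub_const 1).sub_const _
  refine (hconjExp.comp (hM.prodMk measurable_id)).div (Finset.measurable_prod _ fun k _ => ?_)
  have hz := measurable_conjExp 1
  have hzk : Measurable fun s : ℝ => conjExp 1 (s + k / N) := hz.comp (measurable_id.add_const _)
  refine Measurable.ite (MeasurableSet.inter ?_ ?_) (hz.sub hzk) measurable_const
  · exact (hf.measurable.comp (measurable_id.add_const _)) (measurableSet_singleton 1)
  · exact (measurableSet_eq_fun hzk hz).compl

lemma periodic_dualWeight (hf : IsCircleIndicator f) (n : ℕ) :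
    Function.Periodic (dualWeight N n f) 1 := by
  intro s
  have hM : fiberSum N f (N * (s + 1)) = fiberSum N f (N * s) := by
    simpa [mul_add] using (periodic_fiberSum hf.periodic N).nat_mul N (N * s)
  have hnode : ∀ r, nodeDifference f (s + 1) (r + 1) = nodeDifference f s r := fun r => by
    simp only [nodeDifference, hf.periodic r, periodic_conjExp 1 s, periodic_conjExp 1 r]
  simp only [dualWeight, hM, periodic_conjExp _ s, add_right_comm s 1, hnode]

lemma exists_norm_dualWeight_le (N n : ℕ) (f : ℝ → ℤ) : ∃ C, ∀ s, ‖dualWeight N n f s‖ ≤ C := by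
  refine ⟨∏ k ∈ Finset.range N, max 1 ‖1 - conjExp 1 (k / N)‖⁻¹, fun s => ?_⟩
  rw [dualWeight, norm_div, norm_conjExp, one_div, norm_prod, ← Finset.prod_inv_distrib]
  refine Finset.prod_le_prod (fun _ _ => by positivity) fun k _ => ?_
  rw [nodeDifference]
  split_ifs
  · rw [conjExp_add, ← mul_one_sub, norm_mul, norm_conjExp, one_mul]
    exact le_max_right _ _
  · simp

lemma dualWeight_fiber (hf : IsCircleIndicator f) (n : ℕ) {t : ℝ} {j : ℕ}
    (hj : j ∈ fiberIndices N f t) (hn : n < (fiberIndices N f t).card) :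
    dualWeight N n f ((t + j) / N) =
      conjExp 1 ((t + j) / N) ^ ((fiberIndices N f t).card - 1 - n) /
        ∏ k ∈ (fiberIndices N f t).erase j,
          (conjExp 1 ((t + j) / N) - conjExp 1 ((t + k) / N)) := by
  have hjN := fiberIndices_subset_range N f t hj
  have hN : (N : ℝ) ≠ 0 := by
    have := Finset.mem_range.1 hjN
    exact Nat.cast_ne_zero.2 (by omega)
  rw [dualWeight, mul_div_cancel₀ _ hN]
  congr 1
  · rw [show fiberSum N f (t + j) = fiberSum N f t by
      simpa using (periodic_fiberSum hf.periodic N).nat_mul j t, hf.fiberSum_eq_card,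
      ← conjExp_natCast]
    congr 1
    omega
  · set s := (t + j) / N with hs
    have hnode : Function.Periodic (nodeDifference f s) 1 := fun r => by
      simp only [nodeDifference, hf.periodic r, periodic_conjExp 1 r]
    calc ∏ k ∈ Finset.range N, nodeDifference f s (s + k / N)
        = ∏ k ∈ Finset.range N, nodeDifference f s ((t + j + k) / N) := by
          simp only [hs, add_div]
      _ = ∏ k ∈ Finset.range N, nodeDifference f s ((t + k) / N) := by
          simpa using (periodic_prod_range_div hnode N).nat_mul j t
      _ = _ := by
          simp only [nodeDifference]
          rw [Finset.prod_ite, Finset.prod_const_one, mul_one]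
          refine Finset.prod_congr (Finset.ext fun k => ?_) fun _ _ => rfl
          simp only [fiberIndices, Finset.mem_filter, Finset.mem_erase]
          constructor
          · exact fun ⟨hk, h1, hne⟩ => ⟨by rintro rfl; exact hne rfl, hk, h1⟩
          · exact fun ⟨hne, hk, h1⟩ =>
              ⟨hk, h1, fun h => hne (injOn_conjExp_one_fiber N t hk hjN h)⟩

lemma _root_.PeriodicL2.comp_nat_mul {U : ℝ → ℂ} (hU : PeriodicL2 U) (hN : 0 < N) :
    PeriodicL2 fun s => U (N * s) := by
  refine ⟨hU.measurable.comp (measurable_const_mul _), fun s => ?_, ?_⟩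
  · simpa [mul_add] using hU.periodic.nat_mul N (N * s)
  · simpa [div_self (Nat.cast_ne_zero.2 hN.ne' : (N : ℝ) ≠ 0)] using
      (hU.intervalIntegrable_sq 0 N).comp_mul_left (c := (N : ℝ))

lemma exists_twistedFiberSum_eq (hf : IsCircleIndicator f) (hN : 0 < N) (n : ℕ) {U : ℝ → ℂ}
    (hU : PeriodicL2 U) (hs : ∀ t, _root_.superlevel n (fiberSum N f) t = 0 → U t = 0) :
    ∃ u, PeriodicL2 u ∧ (∀ t, f t = 0 → u t = 0) ∧
      ∀ i ≤ n, twistedFiberSum N i u = if i = n then U else 0 := by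
  obtain ⟨C, hC⟩ := exists_norm_dualWeight_le N n f
  refine ⟨fun s => f s * (dualWeight N n f s * U (N * s)), hf.bdd_mul ((hU.comp_nat_mul hN).bdd_mul
    (hf.measurable_dualWeight n) (hf.periodic_dualWeight n) C hC), fun t ht => by simp [ht],
    fun i hi => funext fun t => ?_⟩
  have hsum : twistedFiberSum N i (fun s => f s * (dualWeight N n f s * U (N * s))) t =
      U t * ∑ j ∈ fiberIndices N f t,
        conjExp 1 ((t + j) / N) ^ i * dualWeight N n f ((t + j) / N) := by
    rw [twistedFiberSum, fiberSum, fiberIndices, Finset.sum_filter, Finset.mul_sum]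
    refine Finset.sum_congr rfl fun j _ => ?_
    have hUj : U (t + j) = U t := by simpa using hU.periodic.nat_mul j t
    rw [mul_div_cancel₀ _ (Nat.cast_ne_zero.2 hN.ne'), hUj, conjExp_natCast]
    rcases hf.eq_zero_or_one ((t + j) / N) with h | h
    · simp [h]
    · simp only [h, Int.cast_one, if_true]
      ring
  rw [hsum]
  by_cases hcard : (fiberIndices N f t).card ≤ n
  · rw [hs t ((hf.superlevel_fiberSum_eq_zero_iff t).2 hcard), zero_mul]
    split_ifs
    · exact (hs t ((hf.superlevel_fiberSum_eq_zero_iff t).2 hcard)).symm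
    · rfl
  · rw [not_le] at hcard
    rw [Finset.sum_congr rfl fun j hj => by rw [hf.dualWeight_fiber n hj hcard],
      sum_pow_mul_pow_div_prod_sub ((injOn_conjExp_one_fiber N t).mono
        (Finset.coe_subset.2 (fiberIndices_subset_range N f t))) hcard hi]
    split_ifs <;> simp

lemma exists_unitFourierCoeff_eq (hf : IsCircleIndicator f) (hN : 0 < N) {Λ : ℕ → Set ℤ}
    (H : ∀ n < N, IsRieszSpectrum (_root_.superlevel n (fiberSum N f)) (Λ n))
    {h : ℝ → ℂ} (hh : PeriodicL2 h) {n : ℕ} (hn : n ≤ N) :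
    ∃ g, PeriodicL2 g ∧ (∀ t, f t = 0 → g t = 0) ∧
      ∀ i < n, ∀ l ∈ Λ i, unitFourierCoeff g (N * l + i) = unitFourierCoeff h (N * l + i) := by
  have hNc : (N : ℂ) ≠ 0 := Nat.cast_ne_zero.2 hN.ne'
  induction n with
  | zero => exact ⟨fun _ => 0, PeriodicL2.zero, fun _ _ => rfl, fun i hi => absurd hi (by omega)⟩
  | succ n ih =>
    obtain ⟨g, hg, hgs, hgf⟩ := ih (by omega)
    obtain ⟨U, hU, hUs, hUf⟩ := (H n hn).exists_eq _ ((hh.sub hg).twistedFiberSum hN n)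
    obtain ⟨u, hu, hus, hui⟩ := hf.exists_twistedFiberSum_eq hN n hU hUs
    refine ⟨fun t => g t + u t, hg.add hu, fun t ht => by simp only [hgs t ht, hus t ht, add_zero],
      fun i hi l hl => ?_⟩
    rw [hg.unitFourierCoeff_add hu]
    have hcoeff := unitFourierCoeff_twistedFiberSum hu hN i l
    rw [hui i (by omega)] at hcoeff
    split_ifs at hcoeff with hin
    · subst hin
      rw [hUf l hl, unitFourierCoeff_twistedFiberSum (hh.sub hg) hN,
        hh.unitFourierCoeff_sub hg] at hcoeff
      rw [← mul_left_cancel₀ hNc hcoeff, add_sub_cancel]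
    · have hzero : unitFourierCoeff u (N * l + i) = 0 := by
        simpa [unitFourierCoeff, hNc] using hcoeff.symm
      rw [hzero, add_zero, hgf i (by omega) l hl]

theorem isRieszSpectrum_of_fiberSum (hf : IsCircleIndicator f) (hN : 0 < N) {Λ : ℕ → Set ℤ}
    (H : ∀ n < N, IsRieszSpectrum (_root_.superlevel n (fiberSum N f)) (Λ n)) :
    IsRieszSpectrum f {m | m / (N : ℤ) ∈ Λ (m % (N : ℤ)).toNat} := by
  have hNz : (N : ℤ) ≠ 0 := by omega
  refine ⟨fun g hg hs h0 => hf.ae_eq_zero_of_fiberSum hN H hg hs fun n hn l hl => h0 _ ?_,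
    fun h hh => ?_⟩
  · have hmod : ((N : ℤ) * l + n) % N = n := by
      rw [Int.mul_add_emod_self_left, Int.emod_eq_of_lt (by omega) (by omega)]
    have hdiv : ((N : ℤ) * l + n) / N = l := by
      rw [Int.mul_add_ediv_left _ _ hNz, Int.ediv_eq_zero_of_lt (by omega) (by omega), add_zero]
    simpa only [Set.mem_ofPred_eq, hmod, hdiv, Int.toNat_natCast] using hl
  · obtain ⟨g, hg, hgs, hgf⟩ := hf.exists_unitFourierCoeff_eq hN H hh le_rfl
    refine ⟨g, hg, hgs, fun m hm => ?_⟩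
    have hnonneg := Int.emod_nonneg m hNz
    have hlt := Int.emod_lt_of_pos m (show (0 : ℤ) < N by omega)
    have hcoeff := hgf (m % (N : ℤ)).toNat (by omega) _ hm
    rwa [Int.toNat_of_nonneg hnonneg, Int.mul_ediv_add_emod] at hcoeff

end IsCircleIndicator

/-! ### Small perturbations of the trigonometric system -/

section Perturbation

/-- The Hilbert space `L²(0, 1)`. -/
abbrev UnitL2 : Type := Lp ℂ 2 (volume.restrict (Set.Ioc (0 : ℝ) 1))

lemma norm_sq_eq_integral (x : UnitL2) : ‖x‖ ^ 2 = ∫ t in (0 : ℝ)..1, ‖x t‖ ^ 2 := by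
  have hinner := congr_arg RCLike.re (@L2.inner_def ℝ ℂ ℂ _ _ _ _ _ x x)
  rw [← integral_re (L2.integrable_inner x x)] at hinner
  simp only [← norm_sq_eq_re_inner] at hinner
  rw [hinner, intervalIntegral.integral_of_le zero_le_one]

lemma intervalIntegrable_mul_conjExp {g : ℝ → ℂ}
    (hg : MemLp g 2 (volume.restrict (Set.Ioc (0 : ℝ) 1))) (n : ℤ) :
    IntervalIntegrable (fun t => g t * conjExp n t) volume 0 1 := by
  rw [intervalIntegrable_iff_integrableOn_Ioc_of_le zero_le_one]
  exact (hg.integrable one_le_two).mul_bdd (c := 1) (continuous_conjExp n).aestronglyMeasurable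
    (Eventually.of_forall fun t => (norm_conjExp n t).le)

lemma memℓp_two_of_summable {ι : Type*} {E : ι → Type*} [∀ i, NormedAddCommGroup (E i)]
    {c : ∀ i, E i} (h : Summable fun i => ‖c i‖ ^ 2) : Memℓp c 2 :=
  memℓp_gen (by simpa using h)

lemma memℓp_unitFourierCoeff {g : ℝ → ℂ}
    (hg : MemLp g 2 (volume.restrict (Set.Ioc (0 : ℝ) 1))) : Memℓp (unitFourierCoeff g) 2 :=
  memℓp_two_of_summable (hasSum_sq_unitFourierCoeff hg).summable

/-- The Fourier transform of `L²(0, 1)`, as an isometry into `ℓ²(ℤ)`. -/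
noncomputable def fourierIsometry : UnitL2 →ₗᵢ[ℂ] lp (fun _ : ℤ => ℂ) 2 where
  toFun x := ⟨unitFourierCoeff x, memℓp_unitFourierCoeff (Lp.memLp x)⟩
  map_add' x y := by
    ext n
    change unitFourierCoeff _ n = unitFourierCoeff _ n + unitFourierCoeff _ n
    rw [unitFourierCoeff_congr_ae (Lp.coeFn_add x y)]
    unfold unitFourierCoeff
    rw [← intervalIntegral.integral_add (intervalIntegrable_mul_conjExp (Lp.memLp x) n)
      (intervalIntegrable_mul_conjExp (Lp.memLp y) n)]
    simp only [Pi.add_apply, add_mul]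
  map_smul' a x := by
    ext n
    change unitFourierCoeff _ n = a * unitFourierCoeff _ n
    rw [unitFourierCoeff_congr_ae (Lp.coeFn_smul a x)]
    unfold unitFourierCoeff
    rw [← intervalIntegral.integral_const_mul]
    simp only [Pi.smul_apply, smul_eq_mul, mul_assoc]
  norm_map' x := by
    have hnorm := lp.hasSum_norm (p := 2) (by simp)
      (⟨unitFourierCoeff x, memℓp_unitFourierCoeff (Lp.memLp x)⟩ : lp (fun _ : ℤ => ℂ) 2)
    simp only [ENNReal.toReal_ofNat, Real.rpow_ofNat] at hnorm
    have hsq := (hnorm.unique (hasSum_sq_unitFourierCoeff (Lp.memLp x))).trans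
      (norm_sq_eq_integral x).symm
    exact (sq_eq_sq₀ (norm_nonneg _) (norm_nonneg _)).1 hsq

lemma fourierIsometry_apply (x : UnitL2) (n : ℤ) : fourierIsometry x n = unitFourierCoeff x n := rfl

lemma fourierIsometry_surjective : Function.Surjective fourierIsometry := by
  intro c
  obtain ⟨g, hg, hgc⟩ := exists_periodicL2_unitFourierCoeff_eq c
  refine ⟨hg.memLp.toLp g, ?_⟩
  ext n
  rw [fourierIsometry_apply, unitFourierCoeff_congr_ae hg.memLp.coeFn_toLp, hgc]

/-- The Fourier transform of `L²(0, 1)`, as an isometric isomorphism onto `ℓ²(ℤ)`. -/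
noncomputable def fourierEquiv : UnitL2 ≃ₗᵢ[ℂ] lp (fun _ : ℤ => ℂ) 2 :=
  LinearIsometryEquiv.ofSurjective fourierIsometry fourierIsometry_surjective

lemma fourierEquiv_apply (x : UnitL2) (n : ℤ) : fourierEquiv x n = unitFourierCoeff x n := rfl

lemma norm_pow_mul_le {t : ℝ} (ht : t ∈ Set.Ioc (0 : ℝ) 1) (k : ℕ) (z : ℂ) :
    ‖(t : ℂ) ^ k * z‖ ≤ ‖z‖ := by
  rw [norm_mul, norm_pow, Complex.norm_real, Real.norm_of_nonneg ht.1.le]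
  exact mul_le_of_le_one_left (norm_nonneg _) (pow_le_one₀ ht.1.le ht.2)

lemma memLp_pow_mul (k : ℕ) (x : UnitL2) :
    MemLp (fun t : ℝ => (t : ℂ) ^ k * x t) 2 (volume.restrict (Set.Ioc (0 : ℝ) 1)) :=
  (Lp.memLp x).of_le
    ((by fun_prop : Measurable fun t : ℝ => (t : ℂ) ^ k).aestronglyMeasurable.mul
      (Lp.aestronglyMeasurable x))
    ((ae_restrict_mem measurableSet_Ioc).mono fun _ ht => norm_pow_mul_le ht k _)

/-- Multiplication by `t ^ k` on `L²(0, 1)`. -/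
noncomputable def mulPow (k : ℕ) : UnitL2 →L[ℂ] UnitL2 :=
  LinearMap.mkContinuous
    { toFun x := (memLp_pow_mul k x).toLp _
      map_add' x y := by
        rw [← MemLp.toLp_add]
        refine MemLp.toLp_congr _ _ ?_
        filter_upwards [Lp.coeFn_add x y] with t ht
        simp only [ht, Pi.add_apply, mul_add]
      map_smul' a x := by
        rw [RingHom.id_apply, ← MemLp.toLp_const_smul]
        refine MemLp.toLp_congr _ _ ?_
        filter_upwards [Lp.coeFn_smul a x] with t ht
        simp only [ht, Pi.smul_apply, smul_eq_mul, mul_left_comm] } 1 fun x => by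
    rw [one_mul]
    refine Lp.norm_le_norm_of_ae_le ?_
    filter_upwards [(memLp_pow_mul k x).coeFn_toLp, ae_restrict_mem measurableSet_Ioc] with t h ht
    exact (congr_arg norm h).trans_le (norm_pow_mul_le ht k _)

lemma norm_mulPow_le (k : ℕ) : ‖mulPow k‖ ≤ 1 := LinearMap.mkContinuous_norm_le _ zero_le_one _

lemma coeFn_mulPow (k : ℕ) (x : UnitL2) :
    mulPow k x =ᵐ[volume.restrict (Set.Ioc (0 : ℝ) 1)] fun t : ℝ => (t : ℂ) ^ k * x t :=
  MemLp.coeFn_toLp (memLp_pow_mul k x)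

lemma bijective_of_norm_sub_lt_one {𝕜 E F : Type*} [NontriviallyNormedField 𝕜]
    [NormedAddCommGroup E] [NormedSpace 𝕜 E] [CompleteSpace E] [NormedAddCommGroup F]
    [NormedSpace 𝕜 F] (e : E ≃ₗᵢ[𝕜] F) {T : E →L[𝕜] F}
    (h : ‖(e.toContinuousLinearEquiv : E →L[𝕜] F) - T‖ < 1) : Function.Bijective T := by
  set A : E →L[𝕜] E := (e.symm.toContinuousLinearEquiv : F →L[𝕜] E) ∘L T
  have hA : ‖1 - A‖ < 1 := by
    refine (ContinuousLinearMap.opNorm_le_bound _ (norm_nonneg _) fun x => ?_).trans_lt h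
    have hx : (1 - A) x = e.symm (((e.toContinuousLinearEquiv : E →L[𝕜] F) - T) x) := by
      simp [A]
    rw [hx, LinearIsometryEquiv.norm_map]
    exact ContinuousLinearMap.le_opNorm _ x
  have hunit : IsUnit A := by simpa using isUnit_one_sub_of_norm_lt_one hA
  have hcomp : (T : E → F) = e ∘ A := funext fun x => (e.apply_symm_apply (T x)).symm
  rw [hcomp]
  exact e.bijective.comp (ContinuousLinearMap.isUnit_iff_bijective.1 hunit)

variable {d : ℤ → ℂ} {r : ℝ}

lemma norm_smul_id_le {z : ℂ} (hz : ‖z‖ ≤ r) (k : ℕ) :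
    ‖(z ^ k / k.factorial) • ContinuousLinearMap.id ℂ ℂ‖ ≤ r ^ k / k.factorial := by
  rw [norm_smul, ContinuousLinearMap.norm_id, mul_one, norm_div, norm_pow, Complex.norm_natCast]
  gcongr

/-- The `k`-th term of the expansion, in powers of `d`, of the operator taking `x` to the
coefficients `∫ x(t) exp(d n * t) conjExp n t dt`. -/
noncomputable def perturbationTerm (hd : ∀ n, ‖d n‖ ≤ r) (k : ℕ) :
    UnitL2 →L[ℂ] lp (fun _ : ℤ => ℂ) 2 :=
  (lp.mapCLM 2 (fun n : ℤ => (d n ^ k / k.factorial) • ContinuousLinearMap.id ℂ ℂ)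
    ((norm_nonneg _).trans (norm_smul_id_le (hd 0) k)) fun n => norm_smul_id_le (hd n) k) ∘L
  ((fourierEquiv.toContinuousLinearEquiv : UnitL2 →L[ℂ] lp (fun _ : ℤ => ℂ) 2) ∘L mulPow k)

lemma norm_perturbationTerm_le (hd : ∀ n, ‖d n‖ ≤ r) (k : ℕ) :
    ‖perturbationTerm hd k‖ ≤ r ^ k / k.factorial := by
  have hr : 0 ≤ r ^ k / k.factorial := (norm_nonneg _).trans (norm_smul_id_le (hd 0) k)
  have hfourier : ‖(fourierEquiv.toContinuousLinearEquiv : UnitL2 →L[ℂ] lp (fun _ : ℤ => ℂ) 2) ∘L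
      mulPow k‖ ≤ 1 := by
    refine (ContinuousLinearMap.opNorm_comp_le _ _).trans (mul_le_one₀ ?_ (norm_nonneg _)
      (norm_mulPow_le k))
    exact fourierEquiv.toLinearIsometry.norm_toContinuousLinearMap_le
  refine (ContinuousLinearMap.opNorm_comp_le _ _).trans ?_
  calc _ ≤ r ^ k / k.factorial * 1 := by gcongr; exact lp.norm_mapCLM_le 2 _ hr _
    _ = _ := mul_one _

lemma perturbationTerm_apply (hd : ∀ n, ‖d n‖ ≤ r) (k : ℕ) (x : UnitL2) (n : ℤ) :
    perturbationTerm hd k x n =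
      d n ^ k / k.factorial * unitFourierCoeff (fun t : ℝ => (t : ℂ) ^ k * x t) n := by
  rw [← unitFourierCoeff_congr_ae (coeFn_mulPow k x)]
  rfl

lemma summable_perturbationTerm (hd : ∀ n, ‖d n‖ ≤ r) : Summable (perturbationTerm hd) :=
  Summable.of_norm_bounded (Real.summable_pow_div_factorial r) (norm_perturbationTerm_le hd)

lemma perturbationTerm_zero (hd : ∀ n, ‖d n‖ ≤ r) :
    perturbationTerm hd 0 = (fourierEquiv.toContinuousLinearEquiv : UnitL2 →L[ℂ] _) := by
  ext x n
  rw [perturbationTerm_apply]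
  simp [fourierEquiv_apply]

/-- The operator taking `x` to the coefficients `∫ x(t) exp(d n * t) conjExp n t dt`, see
`perturbedFourier_apply`. -/
noncomputable def perturbedFourier (hd : ∀ n, ‖d n‖ ≤ r) : UnitL2 →L[ℂ] lp (fun _ : ℤ => ℂ) 2 :=
  ∑' k, perturbationTerm hd k

lemma hasSum_integral_exp_mul {x : ℝ → ℂ} (hx : IntervalIntegrable x volume 0 1) (z : ℂ) :
    HasSum (fun k : ℕ => z ^ k / k.factorial * ∫ t in (0 : ℝ)..1, (t : ℂ) ^ k * x t)
      (∫ t in (0 : ℝ)..1, Complex.exp (z * t) * x t) := by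
  simp only [← intervalIntegral.integral_const_mul]
  refine intervalIntegral.hasSum_integral_of_dominated_convergence
    (fun k t => ‖z‖ ^ k / k.factorial * ‖x t‖) (fun k => ?_) (fun k => ?_) ?_ ?_ ?_
  · exact ((by fun_prop : Continuous fun t : ℝ => (t : ℂ) ^ k).aestronglyMeasurable.mul
      hx.aestronglyMeasurable_restrict_uIoc).const_mul _
  · refine Eventually.of_forall fun t ht => ?_
    rw [Set.uIoc_of_le zero_le_one] at ht
    rw [norm_mul, norm_div, norm_pow, Complex.norm_natCast]
    gcongr
    exact norm_pow_mul_le ht k _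
  · exact Eventually.of_forall fun t _ => (Real.summable_pow_div_factorial _).mul_right _
  · simp only [tsum_mul_right]
    exact hx.norm.const_mul _
  · refine Eventually.of_forall fun t _ => ?_
    have hexp := (NormedSpace.expSeries_div_hasSum_exp (z * (t : ℂ))).mul_right (x t)
    rw [← Complex.exp_eq_exp_ℂ] at hexp
    simpa only [mul_pow, mul_div_right_comm, mul_assoc] using hexp

lemma perturbedFourier_apply (hd : ∀ n, ‖d n‖ ≤ r) (x : UnitL2) (n : ℤ) :
    perturbedFourier hd x n = ∫ t in (0 : ℝ)..1, x t * (Complex.exp (d n * t) * conjExp n t) := by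
  have hterm := (lp.evalCLM ℂ (fun _ : ℤ => ℂ) 2 n).hasSum
    ((summable_perturbationTerm hd).hasSum.mapL (ContinuousLinearMap.apply ℂ _ x))
  have hexp := hasSum_integral_exp_mul (intervalIntegrable_mul_conjExp (Lp.memLp x) n) (d n)
  simp only [mul_left_comm (x _)]
  refine hterm.unique (hexp.congr_fun fun k => ?_)
  change perturbationTerm hd k x n = _
  simp only [perturbationTerm_apply, unitFourierCoeff, mul_assoc]

lemma bijective_perturbedFourier (hd : ∀ n, ‖d n‖ ≤ r) (hr : r < Real.log 2) :
    Function.Bijective (perturbedFourier hd) := by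
  refine bijective_of_norm_sub_lt_one fourierEquiv ?_
  have htail : HasSum (fun k : ℕ => r ^ (k + 1) / (k + 1).factorial) (Real.exp r - 1) := by
    have hexp := NormedSpace.expSeries_div_hasSum_exp r
    rw [← Real.exp_eq_exp_ℝ] at hexp
    simpa using (hasSum_nat_add_iff' 1).2 hexp
  rw [perturbedFourier, (summable_perturbationTerm hd).tsum_eq_zero_add, perturbationTerm_zero,
    sub_add_cancel_left, norm_neg]
  exact (tsum_of_norm_bounded htail fun k => norm_perturbationTerm_le hd (k + 1)).trans_lt
    (by linarith [(Real.lt_log_iff_exp_lt two_pos).1 hr])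

variable {ε : ℤ → ℝ}

lemma exp_mul_conjExp (n : ℤ) (δ t : ℝ) :
    Complex.exp (-(2 * Real.pi * Complex.I * δ) * t) * conjExp n t =
      Complex.exp (-(2 * Real.pi * Complex.I * (n + δ) * t)) := by
  rw [conjExp, ← Complex.exp_add]
  congr 1; ring

lemma norm_two_pi_I_mul_le {δ η : ℝ} (hδ : |δ| ≤ η) :
    ‖(-(2 * Real.pi * Complex.I * δ) : ℂ)‖ ≤ 2 * Real.pi * η := by
  simp only [norm_neg, norm_mul, Complex.norm_ofNat, Complex.norm_real, Complex.norm_I, mul_one,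
    Real.norm_eq_abs, abs_of_pos Real.pi_pos]
  gcongr

lemma ae_eq_zero_of_perturbed {η : ℝ} (hη : 2 * Real.pi * η < Real.log 2)
    (hε : ∀ n, |ε n| ≤ η) {g : ℝ → ℂ} (hg : MemLp g 2 (volume.restrict (Set.Ioc (0 : ℝ) 1)))
    (h : ∀ n, ∫ t in (0 : ℝ)..1,
      g t * Complex.exp (-(2 * Real.pi * Complex.I * (n + ε n) * t)) = 0) :
    g =ᵐ[volume.restrict (Set.Ioc (0 : ℝ) 1)] 0 := by
  set T := perturbedFourier fun n => norm_two_pi_I_mul_le (hε n)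
  have hT : T (hg.toLp g) = 0 := by
    ext n
    rw [perturbedFourier_apply, lp.coeFn_zero, Pi.zero_apply, ← h n,
      intervalIntegral.integral_of_le zero_le_one, intervalIntegral.integral_of_le zero_le_one]
    refine integral_congr_ae ?_
    filter_upwards [hg.coeFn_toLp] with t ht
    rw [ht, exp_mul_conjExp]
  have hzero : hg.toLp g = 0 := (bijective_perturbedFourier _ hη).1 (hT.trans (map_zero _).symm)
  exact hg.coeFn_toLp.symm.trans (Lp.eq_zero_iff_ae_eq_zero.1 hzero)

lemma exists_of_perturbed {η : ℝ} (hη : 2 * Real.pi * η < Real.log 2) (hε : ∀ n, |ε n| ≤ η)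
    {c : ℤ → ℂ} (hc : Summable fun n => ‖c n‖ ^ 2) :
    ∃ g, Measurable g ∧ MemLp g 2 (volume.restrict (Set.Ioc (0 : ℝ) 1)) ∧
      ∀ n, ∫ t in (0 : ℝ)..1,
        g t * Complex.exp (-(2 * Real.pi * Complex.I * (n + ε n) * t)) = c n := by
  obtain ⟨x, hx⟩ := (bijective_perturbedFourier (fun n => norm_two_pi_I_mul_le (hε n)) hη).2
    ⟨c, memℓp_two_of_summable hc⟩
  refine ⟨x, (Lp.stronglyMeasurable x).measurable, Lp.memLp x, fun n => ?_⟩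
  have hcoeff := congr_arg (fun y : lp (fun _ : ℤ => ℂ) 2 => y n) hx
  simpa only [perturbedFourier_apply, exp_mul_conjExp] using hcoeff

end Perturbation

/-! ### Arcs -/

/-- The indicator of the arc of length `β` starting at `p` in the circle `ℝ / ℤ`, for
`0 ≤ β ≤ 1`. The formula makes sense for all `β`, and in this form arcs are stable under
`fiberSum`. -/
noncomputable def arcIndicator (p β t : ℝ) : ℤ := ⌊t - p⌋ - ⌊t - p - β⌋

section Arc

lemma arcIndicator_add_intCast (p β : ℝ) (k : ℤ) (t : ℝ) :
    arcIndicator p (β + k) t = arcIndicator p β t + k := by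
  rw [arcIndicator, arcIndicator, ← sub_sub _ β, Int.floor_sub_intCast, sub_sub_eq_add_sub,
    add_sub_right_comm]

lemma arcIndicator_zero (p t : ℝ) : arcIndicator p 0 t = 0 := by simp [arcIndicator]

lemma arcIndicator_one (p t : ℝ) : arcIndicator p 1 t = 1 := by
  simpa [arcIndicator_zero] using arcIndicator_add_intCast p 0 1 t

lemma arcIndicator_eq_ite {p β : ℝ} (h0 : 0 ≤ β) (h1 : β < 1) (t : ℝ) :
    arcIndicator p β t = if Int.fract (t - p) < β then 1 else 0 := by
  have hadd := Int.floor_add_fract (t - p)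
  have hnonneg := Int.fract_nonneg (t - p)
  have hlt := Int.fract_lt_one (t - p)
  unfold arcIndicator
  split_ifs with h
  · have hfloor : ⌊t - p - β⌋ = ⌊t - p⌋ - 1 := by
      rw [Int.floor_eq_iff]; push_cast; constructor <;> linarith
    omega
  · have hfloor : ⌊t - p - β⌋ = ⌊t - p⌋ := by
      rw [Int.floor_eq_iff]; constructor <;> linarith
    omega

lemma isCircleIndicator_arcIndicator (p : ℝ) {β : ℝ} (h0 : 0 ≤ β) (h1 : β ≤ 1) :
    IsCircleIndicator (arcIndicator p β) where
  measurable := (Int.measurable_floor.comp (measurable_id.sub_const p)).sub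
    (Int.measurable_floor.comp ((measurable_id.sub_const p).sub_const β))
  periodic t := by
    simp only [arcIndicator, add_sub_right_comm _ (1 : ℝ), Int.floor_add_one,
      add_sub_add_right_eq_sub]
  eq_zero_or_one t := by
    rcases h1.eq_or_lt with rfl | h1
    · exact Or.inr (arcIndicator_one p t)
    · rw [arcIndicator_eq_ite h0 h1]
      split_ifs <;> simp

lemma fiberSum_arcIndicator {N : ℕ} (hN : 0 < N) (p β : ℝ) :
    fiberSum N (arcIndicator p β) = arcIndicator (N * p) (N * β) := by
  ext t
  simp only [arcIndicator, sub_sub, ← mul_add, ← fiberSum_floor_sub hN]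
  simp only [fiberSum, Finset.sum_sub_distrib, arcIndicator, sub_sub]

lemma abs_arcIndicator_sub_lt_one (p β t : ℝ) : |(arcIndicator p β t : ℝ) - β| < 1 := by
  rw [abs_lt, arcIndicator]
  push_cast
  constructor <;> linarith [Int.floor_le (t - p), Int.lt_floor_add_one (t - p),
    Int.floor_le (t - p - β), Int.lt_floor_add_one (t - p - β)]

lemma superlevel_arcIndicator (n : ℕ) (p β : ℝ) :
    superlevel n (arcIndicator p β) = arcIndicator p (Set.projIcc 0 1 zero_le_one (β - n)) := by
  ext t
  have hsplit : arcIndicator p β t = arcIndicator p (Int.fract β) t + ⌊β⌋ := by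
    rw [← arcIndicator_add_intCast, Int.fract_add_floor]
  have hle := Int.floor_le β
  have hlt := Int.lt_floor_add_one β
  have hfract := (isCircleIndicator_arcIndicator p (Int.fract_nonneg β)
    (Int.fract_lt_one β).le).eq_zero_or_one t
  unfold superlevel
  rcases lt_trichotomy (n : ℤ) ⌊β⌋ with h | h | h
  · have h' : (n : ℝ) + 1 ≤ ⌊β⌋ := by exact_mod_cast h
    rw [Set.projIcc_of_right_le zero_le_one (by linarith), arcIndicator_one, if_pos (by omega)]
  · have h' : (n : ℝ) = ⌊β⌋ := by exact_mod_cast h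
    rw [h', Int.self_sub_floor,
      Set.projIcc_of_mem zero_le_one ⟨Int.fract_nonneg β, (Int.fract_lt_one β).le⟩, hsplit]
    dsimp only
    split_ifs <;> omega
  · have h' : (⌊β⌋ : ℝ) + 1 ≤ n := by exact_mod_cast h
    rw [Set.projIcc_of_le_left zero_le_one (by linarith), arcIndicator_zero, if_neg (by omega)]

lemma le_of_arcIndicator_le {p q a b : ℝ} (h : ∀ t, arcIndicator p a t ≤ arcIndicator q b t) :
    a ≤ b := by
  by_contra! hab
  obtain ⟨N, hN⟩ := exists_nat_gt (2 / (a - b))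
  rw [div_lt_iff₀ (sub_pos.2 hab)] at hN
  have hN0 : 0 < N := Nat.pos_of_ne_zero fun h0 => by
    rw [h0, Nat.cast_zero, zero_mul] at hN; linarith
  have hle := fiberSum_mono h N 0
  rw [fiberSum_arcIndicator hN0, fiberSum_arcIndicator hN0, ← Int.cast_le (R := ℝ)] at hle
  linarith [(abs_lt.1 (abs_arcIndicator_sub_lt_one (N * p) (N * a) 0)).1,
    (abs_lt.1 (abs_arcIndicator_sub_lt_one (N * q) (N * b) 0)).2]

end Arc

lemma isRieszSpectrum_empty {f : ℝ → ℤ} (hf : ∀ t, f t = 0) : IsRieszSpectrum f ∅ :=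
  ⟨fun _ _ hs _ => Eventually.of_forall fun t => hs t (hf t),
    fun _ _ => ⟨fun _ => 0, PeriodicL2.zero, fun _ _ => rfl, fun _ hn => hn.elim⟩⟩

lemma isRieszSpectrum_univ {f : ℝ → ℤ} (hf : ∀ t, f t ≠ 0) : IsRieszSpectrum f Set.univ :=
  ⟨fun _ hg _ h0 => hg.ae_eq_zero fun n => h0 n trivial,
    fun h hh => ⟨h, hh, fun t ht => absurd ht (hf t), fun _ _ => rfl⟩⟩

section SmallArc

variable {p β : ℝ}

lemma unitFourierCoeff_eq_of_support_arc (h0 : 0 < β) (h1 : β < 1) {g : ℝ → ℂ} (hg : PeriodicL2 g)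
    (hs : ∀ t, arcIndicator p β t = 0 → g t = 0) (l : ℤ) :
    unitFourierCoeff g l = β * conjExp l p * ∫ y in (0 : ℝ)..1, g (β * y + p) *
      Complex.exp (-(2 * Real.pi * Complex.I * (β * l) * y)) := by
  have hint := (hg.mul_conjExp l).intervalIntegrable
  have hshift : unitFourierCoeff g l = ∫ t in p..(p + 1), g t * conjExp l t := by
    simpa only [zero_add, unitFourierCoeff] using
      (hg.mul_conjExp l).periodic.intervalIntegral_add_eq 0 p
  have houtside : ∫ t in (p + β)..(p + 1), g t * conjExp l t = 0 := by
    rw [intervalIntegral.integral_congr_Ioo_of_le (g := fun _ => (0 : ℂ)) (by linarith)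
      fun t ht => ?_, intervalIntegral.integral_zero]
    have hfract : Int.fract (t - p) = t - p := by
      rw [Int.fract_eq_self]; constructor <;> linarith [ht.1, ht.2]
    rw [hs t (by rw [arcIndicator_eq_ite h0.le h1, if_neg (by linarith [ht.1])]), zero_mul]
  have hscale : ∫ y in (0 : ℝ)..1, g (β * y + p) * conjExp l (β * y + p) =
      (β : ℂ)⁻¹ * ∫ t in p..(p + β), g t * conjExp l t := by
    rw [intervalIntegral.integral_comp_mul_add (fun t => g t * conjExp l t) h0.ne']
    simp only [mul_zero, zero_add, mul_one, Complex.real_smul, Complex.ofReal_inv, add_comm β p]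
  have hexp : ∀ y : ℝ, g (β * y + p) * conjExp l (β * y + p) = conjExp l p * (g (β * y + p) *
      Complex.exp (-(2 * Real.pi * Complex.I * (β * l) * y))) := fun y => by
    have hy : conjExp l (β * y) = Complex.exp (-(2 * Real.pi * Complex.I * (β * l) * y)) := by
      unfold conjExp; push_cast; ring_nf
    rw [conjExp_add, hy]; ring
  simp only [hexp, intervalIntegral.integral_const_mul] at hscale
  rw [hshift, ← intervalIntegral.integral_add_adjacent_intervals (hint p (p + β)) (hint _ _),
    houtside, add_zero, mul_assoc, hscale,
    mul_inv_cancel_left₀ (by exact_mod_cast h0.ne' : (β : ℂ) ≠ 0)]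

lemma PeriodicL2.memLp_comp_mul_add {g : ℝ → ℂ} (hg : PeriodicL2 g) (hβ : β ≠ 0) :
    MemLp (fun y => g (β * y + p)) 2 (volume.restrict (Set.Ioc (0 : ℝ) 1)) := by
  have hm : Measurable fun y => g (β * y + p) :=
    hg.measurable.comp ((measurable_const_mul β).add_const p)
  rw [memLp_two_iff_integrable_sq_norm hm.aestronglyMeasurable]
  refine (intervalIntegrable_iff_integrableOn_Ioc_of_le zero_le_one).1 ?_
  simpa [div_self hβ] using
    ((hg.intervalIntegrable_sq p (β + p)).comp_add_right p).comp_mul_left (c := β)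

lemma ae_eq_zero_of_support_arc (h0 : 0 < β) (h1 : β < 1) {g : ℝ → ℂ}
    (hg : Function.Periodic g 1) (hs : ∀ t, arcIndicator p β t = 0 → g t = 0)
    (h : (fun y => g (β * y + p)) =ᵐ[volume.restrict (Set.Ioc (0 : ℝ) 1)] 0) :
    ∀ᵐ t, g t = 0 := by
  have hscale : Measure.QuasiMeasurePreserving (fun t : ℝ => β⁻¹ * t) volume volume := by
    refine ⟨measurable_const_mul _, ?_⟩
    rw [Real.map_volume_mul_left (inv_ne_zero h0.ne')]
    exact Measure.smul_absolutelyContinuous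
  have hinside : ∀ᵐ t : ℝ, β⁻¹ * t ∈ Set.Ioc (0 : ℝ) 1 → g (t + p) = 0 := by
    filter_upwards [hscale.ae ((ae_restrict_iff' measurableSet_Ioc).1 h)] with t ht htI
    simpa [mul_inv_cancel_left₀ h0.ne'] using ht htI
  have htranslate : ∀ᵐ t, g (t + p) = 0 := by
    refine ae_of_ae_restrict_Ioc (fun t => by rw [add_right_comm, hg]) ?_
    rw [ae_restrict_iff' measurableSet_Ioc]
    filter_upwards [hinside, Measure.ae_ne volume (1 : ℝ)] with t ht htne htI
    by_cases hle : t ≤ β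
    · exact ht ⟨mul_pos (inv_pos.2 h0) htI.1, by rwa [inv_mul_le_iff₀ h0, mul_one]⟩
    · have hfract : Int.fract (t + p - p) = t := by
        rw [add_sub_cancel_right, Int.fract_eq_self]
        exact ⟨htI.1.le, lt_of_le_of_ne htI.2 htne⟩
      exact hs _ (by rw [arcIndicator_eq_ite h0.le h1, hfract, if_neg fun hlt => hle hlt.le])
  filter_upwards [(measurePreserving_sub_right volume p).quasiMeasurePreserving.ae htranslate]
    with t ht
  simpa using ht

/-- The function of period one supported on the arc of length `β` starting at `p` which is there
the rescaling of `G : (0, 1) → ℂ`. -/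
noncomputable def arcExtension (p β : ℝ) (G : ℝ → ℂ) (t : ℝ) : ℂ :=
  if Int.fract (t - p) < β then G (β⁻¹ * Int.fract (t - p)) else 0

lemma arcExtension_mul_add (h0 : 0 < β) (h1 : β < 1) (G : ℝ → ℂ) {y : ℝ}
    (hy : y ∈ Set.Ioo (0 : ℝ) 1) : arcExtension p β G (β * y + p) = G y := by
  have hlt : β * y < β := mul_lt_of_lt_one_right h0 hy.2
  have hfract : Int.fract (β * y + p - p) = β * y := by
    rw [add_sub_cancel_right, Int.fract_eq_self]
    exact ⟨(mul_pos h0 hy.1).le, hlt.trans h1⟩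
  rw [arcExtension, hfract, if_pos hlt, inv_mul_cancel_left₀ h0.ne']

lemma arcExtension_eq_zero (h0 : 0 < β) (h1 : β < 1) (G : ℝ → ℂ) {t : ℝ}
    (ht : arcIndicator p β t = 0) : arcExtension p β G t = 0 := by
  rw [arcIndicator_eq_ite h0.le h1] at ht
  exact if_neg fun h => by simp [h] at ht

lemma periodicL2_arcExtension (h0 : 0 < β) (h1 : β < 1) {G : ℝ → ℂ} (hGm : Measurable G)
    (hG : MemLp G 2 (volume.restrict (Set.Ioc (0 : ℝ) 1))) :
    PeriodicL2 (arcExtension p β G) := by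
  have hfract : ∀ s ∈ Set.Ioo p (p + 1), Int.fract (s - p) = s - p := fun s hs => by
    rw [Int.fract_eq_self]; constructor <;> linarith [hs.1, hs.2]
  have hm : Measurable fun s : ℝ => Int.fract (s - p) :=
    measurable_fract.comp (measurable_id.sub_const p)
  have hp : Function.Periodic (arcExtension p β G) 1 := fun s => by
    simp only [arcExtension, add_sub_right_comm, Int.fract_add_one]
  have hinside : IntervalIntegrable (fun t => ‖arcExtension p β G t‖ ^ 2) volume p (p + β) := by
    have hGsq : IntervalIntegrable (fun t => ‖G t‖ ^ 2) volume 0 1 := by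
      rw [intervalIntegrable_iff_integrableOn_Ioc_of_le zero_le_one]
      exact (memLp_two_iff_integrable_sq_norm hG.1).1 hG
    have hscale := (hGsq.comp_mul_left (c := β⁻¹)).comp_sub_right p
    rw [zero_div, div_inv_eq_mul, one_mul, zero_add, add_comm β p,
      intervalIntegrable_iff_integrableOn_Ioo_of_le (by linarith)] at hscale
    rw [intervalIntegrable_iff_integrableOn_Ioo_of_le (by linarith)]
    refine hscale.congr_fun (fun s hs => ?_) measurableSet_Ioo
    rw [arcExtension, hfract s ⟨hs.1, by linarith [hs.2]⟩, if_pos (by linarith [hs.2])]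
  have houtside : IntervalIntegrable (fun t => ‖arcExtension p β G t‖ ^ 2) volume
      (p + β) (p + 1) := by
    rw [intervalIntegrable_iff_integrableOn_Ioo_of_le (by linarith)]
    refine (integrableOn_zero (ε' := ℝ)).congr_fun (fun s hs => ?_) measurableSet_Ioo
    rw [arcExtension, hfract s ⟨by linarith [hs.1], hs.2⟩, if_neg (by linarith [hs.1])]
    simp
  exact ⟨Measurable.ite (measurableSet_lt hm measurable_const)
      (hGm.comp (hm.const_mul _)) measurable_const, hp,
    (hp.comp fun z => ‖z‖ ^ 2).intervalIntegrable one_ne_zero (hinside.trans houtside) 0 1⟩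

lemma abs_mul_round_div_sub_le (h0 : 0 < β) (x : ℝ) : |β * round (x / β) - x| ≤ β * (1 / 2) := by
  have hx : β * round (x / β) - x = -(β * (x / β - round (x / β))) := by
    rw [mul_sub, mul_div_cancel₀ _ h0.ne', neg_sub]
  rw [hx, abs_neg, abs_mul, abs_of_pos h0]
  exact mul_le_mul_of_nonneg_left (abs_sub_round _) h0.le

lemma injective_round_intCast_div (h0 : 0 < β) (h1 : β < 1) :
    Function.Injective fun n : ℤ => round ((n : ℝ) / β) := by
  intro m n hmn
  have hm := abs_le.1 (abs_mul_round_div_sub_le h0 m)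
  have hn := abs_le.1 (abs_mul_round_div_sub_le h0 n)
  simp only at hmn
  rw [hmn] at hm
  have hlt : |(m - n : ℤ)| < 1 := by
    rw [← Int.cast_lt (R := ℝ), Int.cast_abs, abs_lt]
    push_cast
    constructor <;> linarith
  exact sub_eq_zero.1 (Int.abs_lt_one_iff.1 hlt)

/-- On an arc of length `β` the integers nearest to the points of `β⁻¹ ℤ` are a perturbation of the
orthogonal system of frequencies, whose relative size is at most `β / 2`. -/
theorem exists_isRieszSpectrum_arcIndicator_of_pi_mul_lt (h0 : 0 < β)
    (hβ : Real.pi * β < Real.log 2) :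
    ∃ Λ : Set ℤ, ∀ p, IsRieszSpectrum (arcIndicator p β) Λ := by
  have h1 : β < 1 := by nlinarith [Real.pi_gt_three, Real.log_two_lt_d9]
  set lam : ℤ → ℤ := fun n => round ((n : ℝ) / β) 
  set ε : ℤ → ℝ := fun n => β * lam n - n with hε
  have hεle : ∀ n, |ε n| ≤ β * (1 / 2) := fun n => abs_mul_round_div_sub_le h0 n
  have hlog : 2 * Real.pi * (β * (1 / 2)) < Real.log 2 := by linarith
  have hfreq : ∀ n : ℤ, (n : ℂ) + ε n = β * lam n := fun n => by
    simp only [hε]; push_cast; ring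
  have hne : ∀ n p, (β : ℂ) * conjExp (lam n) p ≠ 0 := fun n p =>
    mul_ne_zero (by exact_mod_cast h0.ne') (conjExp_ne_zero _ _)
  refine ⟨Set.range lam, fun p => ⟨fun g hg hs hz => ?_, fun h hh => ?_⟩⟩
  · refine ae_eq_zero_of_support_arc h0 h1 hg.periodic hs
      (ae_eq_zero_of_perturbed hlog hεle (hg.memLp_comp_mul_add h0.ne') fun n => ?_)
    have hcoeff := hz (lam n) ⟨n, rfl⟩
    rw [unitFourierCoeff_eq_of_support_arc h0 h1 hg hs] at hcoeff
    simpa only [hfreq] using (mul_eq_zero.1 hcoeff).resolve_left (hne n p)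
  · have hsum : Summable fun n => ‖(β * conjExp (lam n) p)⁻¹ * unitFourierCoeff h (lam n)‖ ^ 2 := by
      refine ((hh.summable_sq_unitFourierCoeff.comp_injective
        (injective_round_intCast_div h0 h1)).mul_left (β⁻¹ ^ 2)).congr fun n => ?_
      simp only [Function.comp_apply, norm_mul, norm_inv, norm_conjExp, mul_one, Complex.norm_real,
        Real.norm_of_nonneg h0.le, mul_pow, lam]
    obtain ⟨G, hGm, hG, hGcoeff⟩ := exists_of_perturbed hlog hεle hsum
    have hg := periodicL2_arcExtension (p := p) h0 h1 hGm hG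
    have hs := fun t => arcExtension_eq_zero (p := p) (t := t) h0 h1 G
    refine ⟨arcExtension p β G, hg, hs, ?_⟩
    rintro _ ⟨n, rfl⟩
    have hcoeff := hGcoeff n
    simp only [hfreq] at hcoeff
    rw [unitFourierCoeff_eq_of_support_arc h0 h1 hg hs,
      intervalIntegral.integral_congr_Ioo_of_le zero_le_one fun y hy => by
        rw [arcExtension_mul_add h0 h1 G hy],
      hcoeff, mul_inv_cancel_left₀ (hne n p)]

end SmallArc

lemma exists_pos_fract_nat_mul_le (x : ℝ) {ε : ℝ} (hε : 0 < ε) :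
    ∃ N : ℕ, 0 < N ∧ Int.fract (N * x) ≤ ε := by
  obtain ⟨n, hn⟩ := exists_nat_one_div_lt hε
  obtain ⟨k, hk0, -, hk⟩ := Real.exists_nat_abs_mul_sub_round_le x n.succ_pos
  set e : ℝ := round ((k : ℝ) * x) - k * x with he
  have hcast : (0 : ℝ) < n + 1 := by positivity
  have hsmall : |e| ≤ ε ∧ |e| < 1 := by
    rw [he, abs_sub_comm]
    refine ⟨hk.trans ((one_div_le_one_div_of_le hcast (by push_cast; linarith)).trans hn.le),
      hk.trans_lt ?_⟩
    rw [div_lt_one (by positivity)]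
    push_cast; linarith
  rcases le_or_gt e 0 with h | h
  · rw [abs_of_nonpos h] at hsmall
    have hfract : Int.fract ((k : ℝ) * x) = -e :=
      Int.fract_eq_iff.2 ⟨by linarith, hsmall.2, round ((k : ℝ) * x), by rw [he]; ring⟩
    exact ⟨k, hk0, hfract.trans_le hsmall.1⟩
  · rw [abs_of_pos h] at hsmall
    -- The multiples of `x` by multiples of `k` move down in steps of length `e ≤ ε` modulo `1`:
    -- go once around the circle and stop just before completing the turn.
    obtain ⟨M, hM⟩ := Nat.exists_eq_add_of_lt
      (Nat.lt_ceil.2 (by rw [Nat.cast_one]; exact (one_lt_div h).2 hsmall.2) : 1 < ⌈1 / e⌉₊)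
    have hup : 1 ≤ ((M + 2 : ℕ) : ℝ) * e := by
      rw [← div_le_iff₀ h]; exact (Nat.le_ceil _).trans_eq (by rw [hM]; push_cast; ring)
    have hdown : ((M + 1 : ℕ) : ℝ) * e < 1 := by
      rw [← lt_div_iff₀ h]
      have := Nat.ceil_lt_add_one (one_div_pos.2 h).le
      rw [hM] at this
      push_cast at this ⊢
      linarith
    push_cast at hup hdown
    have hfract : Int.fract ((((M + 1) * k : ℕ) : ℝ) * x) = 1 - (M + 1) * e :=
      Int.fract_eq_iff.2 ⟨by linarith, by linarith [show (0 : ℝ) < (M + 1) * e by positivity],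
        (M + 1) * round ((k : ℝ) * x) - 1, by push_cast; rw [he]; ring⟩
    exact ⟨(M + 1) * k, by positivity, by linarith [hfract]⟩

theorem exists_isRieszSpectrum_arcIndicator (β : unitInterval) :
    ∃ Λ : Set ℤ, ∀ p, IsRieszSpectrum (arcIndicator p β) Λ := by
  have hlog : 0 < Real.log 2 := Real.log_pos one_lt_two
  obtain ⟨N, hN, hfract⟩ := exists_pos_fract_nat_mul_le β (div_pos hlog four_pos)
  have hsuperlevel : ∀ n : ℕ, ∃ Λ : Set ℤ, ∀ p,
      IsRieszSpectrum (arcIndicator p (Set.projIcc 0 1 zero_le_one ((N : ℝ) * β - n))) Λ := by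
    intro n
    rcases le_or_gt ((N : ℝ) * β - n) 0 with h0 | h0
    · rw [Set.projIcc_of_le_left zero_le_one h0]
      exact ⟨∅, fun p => isRieszSpectrum_empty (arcIndicator_zero p)⟩
    rcases le_or_gt 1 ((N : ℝ) * β - n) with h1 | h1
    · rw [Set.projIcc_of_right_le zero_le_one h1]
      exact ⟨Set.univ, fun p => isRieszSpectrum_univ fun t => by simp [arcIndicator_one]⟩
    · rw [Set.projIcc_of_mem zero_le_one ⟨h0.le, h1.le⟩]
      have hsub : Int.fract ((N : ℝ) * β) = N * β - n :=
        Int.fract_eq_iff.2 ⟨h0.le, h1, n, by push_cast; ring⟩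
      refine exists_isRieszSpectrum_arcIndicator_of_pi_mul_lt h0 ?_
      nlinarith [Real.pi_lt_four]
  choose Λ hΛ using hsuperlevel
  refine ⟨{m | m / (N : ℤ) ∈ Λ (m % (N : ℤ)).toNat}, fun p =>
    (isCircleIndicator_arcIndicator p β.2.1 β.2.2).isRieszSpectrum_of_fiberSum hN fun n _ => ?_⟩
  rw [fiberSum_arcIndicator hN, superlevel_arcIndicator]
  exact hΛ n _

lemma exists_spectra_of_arcIndicator : ∃ Λ : unitInterval → Set ℤ, Λ 0 = ∅ ∧ Λ 1 = Set.univ ∧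
    ∀ (β : unitInterval) (p : ℝ), IsRieszSpectrum (arcIndicator p β) (Λ β) := by
  choose Λ hΛ using exists_isRieszSpectrum_arcIndicator
  refine ⟨Function.update (Function.update Λ 1 Set.univ) 0 ∅, Function.update_self ..,
    by rw [Function.update_of_ne one_ne_zero, Function.update_self], fun β p => ?_⟩
  rcases eq_or_ne β 0 with rfl | h0
  · rw [Function.update_self]
    exact isRieszSpectrum_empty (arcIndicator_zero p)
  rcases eq_or_ne β 1 with rfl | h1
  · rw [Function.update_of_ne h0, Function.update_self]
    exact isRieszSpectrum_univ fun t => by simp [arcIndicator_one]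
  · rw [Function.update_of_ne h0, Function.update_of_ne h1]
    exact hΛ β p

/-- The conclusion of the main theorem for a family of indicators of sets of the circle: Riesz
bases of exponentials which increase with the sets. -/
def HasNestedRieszSpectra {ι : Type*} [Preorder ι] (f : ι → ℝ → ℤ) : Prop :=
  ∃ Λ : ι → Set ℤ, Monotone Λ ∧ ∀ k, IsRieszSpectrum (f k) (Λ k)

/-- For `N` large, of any two superlevel sets at the same height of the `fiberSum N` of arcs of
different lengths either the smaller is empty or the larger is everything. -/
theorem hasNestedRieszSpectra_of_arcs {ι : Type*} [Finite ι] [Preorder ι] {f : ι → ℝ → ℤ}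
    (hf : Monotone f) (ha : ∀ k, ∃ p, ∃ β : unitInterval, f k = arcIndicator p β) :
    HasNestedRieszSpectra f := by
  choose p β hfe using ha
  obtain ⟨Λ, hΛ0, hΛ1, hΛ⟩ := exists_spectra_of_arcIndicator
  have hβ : ∀ k l, k ≤ l → (β k : ℝ) ≤ β l := fun k l hkl =>
    le_of_arcIndicator_le (p := p k) (q := p l) fun t => by rw [← hfe, ← hfe]; exact hf hkl t
  obtain ⟨N, hgap, hN⟩ : ∃ N : ℕ, (∀ k l, (β k : ℝ) < β l → 1 ≤ N * ((β l : ℝ) - β k)) ∧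
      0 < N := by
    refine ((eventually_all.2 fun k => eventually_all.2 fun l => ?_).and
      (eventually_gt_atTop 0)).exists
    rw [eventually_imp_distrib_left]
    exact fun h => ((tendsto_natCast_atTop_atTop (R := ℝ)).atTop_mul_const
      (sub_pos.2 h)).eventually_ge_atTop 1
  refine ⟨fun k => {m | m / (N : ℤ) ∈
    Λ (Set.projIcc 0 1 zero_le_one ((N : ℝ) * β k - (m % (N : ℤ)).toNat))},
    fun k l hkl m hm => ?_, fun k => ?_⟩
  · simp only [Set.mem_ofPred_eq] at hm ⊢
    rcases (hβ k l hkl).eq_or_lt with h | h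
    · rwa [← h]
    rcases le_or_gt ((N : ℝ) * β k - (m % (N : ℤ)).toNat) 0 with h0 | h0
    · rw [Set.projIcc_of_le_left zero_le_one h0] at hm
      exact (hΛ0.subset hm).elim
    · rw [Set.projIcc_of_right_le zero_le_one (by linarith [hgap k l h])]
      exact hΛ1.superset trivial
  · rw [hfe]
    refine (isCircleIndicator_arcIndicator (p k) (β k).2.1 (β k).2.2).isRieszSpectrum_of_fiberSum
      (Λ := fun n => Λ (Set.projIcc 0 1 zero_le_one ((N : ℝ) * β k - n))) hN fun n _ => ?_
    rw [fiberSum_arcIndicator hN, superlevel_arcIndicator]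
    exact hΛ _ _

/-! ### Dilations of a step function with large variance -/

lemma conjExp_neg (m : ℤ) (t : ℝ) : conjExp (-m) t = (starRingEnd ℂ) (conjExp m t) := by
  simp only [conjExp, ← Complex.exp_conj, map_neg, map_mul, Complex.conj_ofReal, Complex.conj_I,
    map_ofNat, map_intCast]
  push_cast
  ring_nf

lemma conjExp_apply_neg (m : ℤ) (t : ℝ) : conjExp m (-t) = (starRingEnd ℂ) (conjExp m t) := by
  rw [← conjExp_neg]
  simp only [conjExp]
  push_cast
  ring_nf

lemma conjExp_apply_intCast (m k : ℤ) : conjExp m k = 1 := by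
  rw [← zero_add (k : ℝ), conjExp_add_int, conjExp, Complex.ofReal_zero, mul_zero, neg_zero,
    Complex.exp_zero]

lemma integral_conjExp {m : ℤ} (hm : m ≠ 0) (a b : ℝ) :
    ∫ t in a..b, conjExp m t = (conjExp m a - conjExp m b) / (2 * Real.pi * Complex.I * m) := by
  have hc : (-(2 * Real.pi * Complex.I * m) : ℂ) ≠ 0 := by simp [Real.pi_ne_zero, hm]
  have hexp : ∀ t : ℝ, conjExp m t = Complex.exp (-(2 * Real.pi * Complex.I * m) * t) :=
    fun t => by rw [conjExp, neg_mul]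
  simp only [hexp, integral_exp_mul_complex hc]
  rw [← neg_sub, neg_div_neg_eq]

lemma intervalIntegrable_floor_mul_conjExp (q : ℝ) (m : ℤ) (a b : ℝ) :
    IntervalIntegrable (fun t => (⌊t - q⌋ : ℂ) * conjExp m t) volume a b := by
  have hmono : Monotone fun t : ℝ => (⌊t - q⌋ : ℝ) := fun s t hst =>
    Int.cast_le.2 (Int.floor_le_floor (by linarith))
  have hint := hmono.intervalIntegrable (μ := volume) (a := a) (b := b)
  have hcast : IntervalIntegrable (fun t => ((⌊t - q⌋ : ℝ) : ℂ)) volume a b :=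
    ⟨hint.1.ofReal, hint.2.ofReal⟩
  simp only [Complex.ofReal_intCast] at hcast
  exact hcast.mul_continuousOn (continuous_conjExp m).continuousOn

lemma unitFourierCoeff_floor (q : ℝ) {m : ℤ} (hm : m ≠ 0) :
    unitFourierCoeff (fun t => (⌊t - q⌋ : ℂ)) m =
      (conjExp m q - 1) / (2 * Real.pi * Complex.I * m) := by
  have hint := intervalIntegrable_floor_mul_conjExp q m
  have hq0 := Int.fract_nonneg q
  have hq1 := Int.fract_lt_one q
  have hq := Int.floor_add_fract q
  have hbelow : ∫ t in (0 : ℝ)..Int.fract q, (⌊t - q⌋ : ℂ) * conjExp m t =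
      ∫ t in (0 : ℝ)..Int.fract q, ((-⌊q⌋ - 1 : ℤ) : ℂ) * conjExp m t := by
    refine intervalIntegral.integral_congr_Ioo_of_le hq0 fun t ht => ?_
    have hfloor : ⌊t - q⌋ = -⌊q⌋ - 1 := by
      rw [Int.floor_eq_iff]; push_cast; constructor <;> linarith [ht.1, ht.2]
    simp only [hfloor]
  have habove : ∫ t in Int.fract q..1, (⌊t - q⌋ : ℂ) * conjExp m t =
      ∫ t in Int.fract q..1, ((-⌊q⌋ : ℤ) : ℂ) * conjExp m t := by
    refine intervalIntegral.integral_congr_Ioo_of_le hq1.le fun t ht => ?_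
    have hfloor : ⌊t - q⌋ = -⌊q⌋ := by
      rw [Int.floor_eq_iff]; push_cast; constructor <;> linarith [ht.1, ht.2]
    simp only [hfloor]
  have hfract : conjExp m (Int.fract q) = conjExp m q := by
    rw [← conjExp_add_int m (Int.fract q) ⌊q⌋, Int.fract_add_floor]
  have hone : conjExp m 1 = 1 := by simpa using conjExp_apply_intCast m 1
  have hzero : conjExp m 0 = 1 := by simpa using conjExp_apply_intCast m 0
  rw [unitFourierCoeff, ← intervalIntegral.integral_add_adjacent_intervals
      (hint 0 (Int.fract q)) (hint _ 1), hbelow, habove, intervalIntegral.integral_const_mul,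
    intervalIntegral.integral_const_mul, integral_conjExp hm, integral_conjExp hm, hone, hzero,
    hfract]
  push_cast
  ring

/-- Bessel's inequality combined with Popoviciu's bound on the variance. -/
lemma sum_sq_unitFourierCoeff_le_of_mem_Icc {F : ℝ → ℝ} {a b : ℝ} (hF : Measurable F)
    (hab : ∀ t, F t ∈ Set.Icc a b) {s : Finset ℤ} (hs : 0 ∉ s) :
    ∑ n ∈ s, ‖unitFourierCoeff (fun t => (F t : ℂ)) n‖ ^ 2 ≤ ((b - a) / 2) ^ 2 := by
  set μ : Measure ℝ := volume.restrict (Set.Ioc 0 1) with hμ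
  have : IsProbabilityMeasure μ := ⟨by simp [hμ]⟩
  have hL : MemLp F 2 μ := memLp_of_bounded (Eventually.of_forall hab) hF.aestronglyMeasurable 2
  have hmean : ‖unitFourierCoeff (fun t => (F t : ℂ)) 0‖ ^ 2 = (∫ t, F t ∂μ) ^ 2 := by
    simp only [unitFourierCoeff, conjExp, Int.cast_zero, mul_zero, zero_mul, neg_zero,
      Complex.exp_zero, mul_one, intervalIntegral.integral_of_le zero_le_one, hμ,
      integral_complex_ofReal, Complex.norm_real, Real.norm_eq_abs, sq_abs]
  have hbessel := sum_le_hasSum (insert 0 s) (fun n _ => by positivity)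
    (hasSum_sq_unitFourierCoeff (g := fun t => (F t : ℂ)) hL.ofReal)
  have hvar := ProbabilityTheory.variance_le_sq_of_bounded (μ := μ) (Eventually.of_forall hab)
    hF.aemeasurable
  rw [ProbabilityTheory.variance_eq_sub hL] at hvar
  rw [Finset.sum_insert hs, hmean, intervalIntegral.integral_of_le zero_le_one] at hbessel
  simp only [Pi.pow_apply, Complex.norm_real, Real.norm_eq_abs, sq_abs] at hbessel hvar
  linarith

section jumpSum

variable {ι : Type*} (X : Finset ι) (w : ι → ℤ) (p : ι → ℝ)

/-- The Fourier coefficients of the jump measure `∑ w x • δ (p x)` of a step function. -/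
noncomputable def jumpSum (m : ℤ) : ℂ := ∑ x ∈ X, (w x : ℂ) * conjExp m (p x)

lemma unitFourierCoeff_staircase (hw : ∑ x ∈ X, w x = 0) (c : ℤ) {m : ℤ} (hm : m ≠ 0) :
    unitFourierCoeff (fun t => (staircase X w p c t : ℂ)) m =
      jumpSum X w p m / (2 * Real.pi * Complex.I * m) := by
  have hexpand : ∀ t : ℝ, (staircase X w p c t : ℂ) * conjExp m t =
      c * conjExp m t + ∑ x ∈ X, (w x : ℂ) * ((⌊t - p x⌋ : ℂ) * conjExp m t) := fun t => by
    simp only [staircase, Int.cast_add, Int.cast_sum, Int.cast_mul, add_mul, Finset.sum_mul,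
      mul_assoc]
  have hconst : ∫ t in (0 : ℝ)..1, (c : ℂ) * conjExp m t = 0 := by
    have hperiod : conjExp m 1 = conjExp m 0 := by simpa using periodic_conjExp m 0
    rw [intervalIntegral.integral_const_mul, integral_conjExp hm, hperiod, sub_self, zero_div,
      mul_zero]
  have hint : ∀ x ∈ X, IntervalIntegrable (fun t => (w x : ℂ) * ((⌊t - p x⌋ : ℂ) * conjExp m t))
      volume 0 1 := fun x _ => (intervalIntegrable_floor_mul_conjExp (p x) m 0 1).const_mul _
  have hfloor : ∀ x ∈ X, ∫ t in (0 : ℝ)..1, (w x : ℂ) * ((⌊t - p x⌋ : ℂ) * conjExp m t) =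
      (w x * conjExp m (p x) - w x) / (2 * Real.pi * Complex.I * m) := fun x _ => by
    rw [intervalIntegral.integral_const_mul, ← unitFourierCoeff, unitFourierCoeff_floor (p x) hm]
    ring
  have hw' : ∑ x ∈ X, (w x : ℂ) = 0 := by exact_mod_cast hw
  simp only [unitFourierCoeff, hexpand]
  rw [intervalIntegral.integral_add (((continuous_conjExp m).intervalIntegrable 0 1).const_mul _)
    (by simpa only [Finset.sum_fn] using IntervalIntegrable.sum X hint), hconst, zero_add,
    intervalIntegral.integral_finsetSum hint, Finset.sum_congr rfl hfloor, ← Finset.sum_div,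
    Finset.sum_sub_distrib, hw', sub_zero, jumpSum]

lemma norm_jumpSum_neg (m : ℤ) : ‖jumpSum X w p (-m)‖ = ‖jumpSum X w p m‖ := by
  rw [← RCLike.norm_conj (jumpSum X w p m)]
  simp only [jumpSum, conjExp_neg, map_sum, map_mul, map_intCast]

lemma norm_sq_unitFourierCoeff_staircase (hw : ∑ x ∈ X, w x = 0) (c : ℤ) {m : ℤ} (hm : m ≠ 0) :
    ‖unitFourierCoeff (fun t => (staircase X w p c t : ℂ)) m‖ ^ 2 =
      ‖jumpSum X w p m‖ ^ 2 / (4 * Real.pi ^ 2 * m ^ 2) := by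
  rw [unitFourierCoeff_staircase X w p hw c hm, norm_div, div_pow]
  simp only [norm_mul, Complex.norm_ofNat, Complex.norm_real, Complex.norm_I, mul_one,
    Complex.norm_intCast, mul_pow, Real.norm_eq_abs, sq_abs]
  norm_num

lemma norm_sq_jumpSum_le_of_two_valued (hw : ∑ x ∈ X, w x = 0) {c v : ℤ}
    (h : ∀ t, staircase X w p c t = v ∨ staircase X w p c t = v + 1) :
    ‖jumpSum X w p 1‖ ^ 2 + ‖jumpSum X w p 2‖ ^ 2 / 4 ≤ Real.pi ^ 2 / 2 := by
  have hmeas : Measurable fun t => (staircase X w p c t : ℝ) :=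
    measurable_from_top.comp (isStep_staircase X w p c hw).measurable
  have hvariance := sum_sq_unitFourierCoeff_le_of_mem_Icc (a := v) (b := v + 1) hmeas
    (fun t => by rcases h t with h | h <;> simp [h]) (s := {-2, -1, 1, 2}) (by decide)
  simp only [Complex.ofReal_intCast] at hvariance
  rw [Finset.sum_insert (by decide), Finset.sum_insert (by decide),
    Finset.sum_insert (by decide), Finset.sum_singleton] at hvariance
  simp only [norm_sq_unitFourierCoeff_staircase X w p hw c (show (-2 : ℤ) ≠ 0 by decide),
    norm_sq_unitFourierCoeff_staircase X w p hw c (show (-1 : ℤ) ≠ 0 by decide),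
    norm_sq_unitFourierCoeff_staircase X w p hw c (show (1 : ℤ) ≠ 0 by decide),
    norm_sq_unitFourierCoeff_staircase X w p hw c (show (2 : ℤ) ≠ 0 by decide),
    norm_jumpSum_neg] at hvariance
  push_cast at hvariance
  rw [← div_le_div_iff_of_pos_right (show 0 < 2 * Real.pi ^ 2 by positivity)]
  calc _ = _ := by field_simp; ring
    _ ≤ _ := hvariance
    _ = _ := by field_simp; ring

lemma tendsto_average_pow {r : ℂ} (hr : ‖r‖ = 1) :
    Tendsto (fun M : ℕ => (∑ N ∈ Finset.range M, r ^ (N + 1)) / (M : ℂ)) atTop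
      (𝓝 (if r = 1 then 1 else 0)) := by
  split_ifs with h
  · subst h
    refine tendsto_const_nhds.congr' ?_
    filter_upwards [eventually_gt_atTop 0] with M hM
    simp [div_self (Nat.cast_ne_zero.2 hM.ne' : (M : ℂ) ≠ 0)]
  · have hsum : ∀ M : ℕ, ∑ N ∈ Finset.range M, r ^ (N + 1) = r * ((r ^ M - 1) / (r - 1)) :=
      fun M => by simp only [← geom_sum_eq h, Finset.mul_sum, pow_succ']
    refine squeeze_zero_norm (fun M => ?_)
      (tendsto_const_div_atTop_nhds_zero_nat (2 / ‖r - 1‖))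
    rw [norm_div, Complex.norm_natCast, hsum, norm_mul, hr, one_mul, norm_div]
    gcongr
    calc ‖r ^ M - 1‖ ≤ ‖r ^ M‖ + ‖(1 : ℂ)‖ := norm_sub_le _ _
      _ = 2 := by rw [norm_pow, hr, one_pow, norm_one]; norm_num

lemma norm_sq_jumpSum (m : ℤ) (N : ℕ) :
    ((‖jumpSum X w (fun x => N * p x) m‖ ^ 2 : ℝ) : ℂ) =
      ∑ x ∈ X, ∑ y ∈ X, (w x : ℂ) * w y * conjExp m (p x - p y) ^ N := by
  have hpow : ∀ t : ℝ, conjExp m (N * t) = conjExp m t ^ N := fun t => by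
    rw [← conjExp_natCast_mul]
    simp only [conjExp, ← Complex.exp_nat_mul]
    push_cast
    ring_nf
  rw [← Complex.normSq_eq_norm_sq, ← Complex.mul_conj, jumpSum, map_sum, Finset.sum_mul_sum]
  refine Finset.sum_congr rfl fun x _ => Finset.sum_congr rfl fun y _ => ?_
  rw [sub_eq_add_neg, conjExp_add, conjExp_apply_neg, map_mul, hpow, hpow, mul_pow, map_pow,
    map_intCast]
  ring

lemma tendsto_average_norm_sq_jumpSum (m : ℤ) :
    Tendsto (fun M : ℕ => (∑ N ∈ Finset.range M,
        ‖jumpSum X w (fun x => ((N + 1 : ℕ) : ℝ) * p x) m‖ ^ 2) / (M : ℝ)) atTop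
      (𝓝 (∑ x ∈ X, ∑ y ∈ X,
        (w x : ℝ) * w y * (if conjExp m (p x - p y) = 1 then 1 else 0))) := by
  rw [← tendsto_ofReal_iff]
  have hlim : Tendsto (fun M : ℕ => ∑ x ∈ X, ∑ y ∈ X, (w x : ℂ) * w y *
      ((∑ N ∈ Finset.range M, conjExp m (p x - p y) ^ (N + 1)) / (M : ℂ))) atTop
      (𝓝 (∑ x ∈ X, ∑ y ∈ X, (w x : ℂ) * w y * (if conjExp m (p x - p y) = 1 then 1 else 0))) :=
    tendsto_finsetSum _ fun x _ => tendsto_finsetSum _ fun y _ =>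
      (tendsto_average_pow (norm_conjExp m _)).const_mul _
  convert hlim using 1
  · ext M
    rw [Complex.ofReal_div, Complex.ofReal_sum, Complex.ofReal_natCast]
    simp only [norm_sq_jumpSum, ← mul_div_assoc, ← Finset.sum_div, Finset.mul_sum]
    rw [Finset.sum_comm]
    simp only [Finset.sum_comm (s := Finset.range M)]
  · push_cast [apply_ite Complex.ofReal]
    rfl

variable {X w p}

lemma sum_sq_le_average_norm_sq_jumpSum
    (hs : ∀ x ∈ X, ∀ y ∈ X, ∀ m : ℕ, 0 < m → ∀ k : ℤ, m * (p x - p y) = k → 0 ≤ w x * w y)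
    {m : ℕ} (hm : 0 < m) : ((∑ x ∈ X, w x ^ 2 : ℤ) : ℝ) ≤
      ∑ x ∈ X, ∑ y ∈ X, (w x : ℝ) * w y * (if conjExp m (p x - p y) = 1 then 1 else 0) := by
  have hnonneg : ∀ x ∈ X, ∀ y ∈ X,
      0 ≤ (w x : ℝ) * w y * (if conjExp m (p x - p y) = 1 then 1 else 0) := by
    intro x hx y hy
    split_ifs with h
    · rw [← mul_one (m : ℤ), conjExp_natCast_mul, ← conjExp_apply_intCast 1 0,
        conjExp_one_eq_iff] at h
      obtain ⟨k, hk⟩ := h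
      have := hs x hx y hy m hm k (by simpa using hk)
      rw [mul_one]
      exact_mod_cast this
    · rw [mul_zero]
  push_cast
  refine Finset.sum_le_sum fun x hx => le_trans ?_ (Finset.single_le_sum (hnonneg x hx) hx)
  rw [sub_self, if_pos (by simpa using conjExp_apply_intCast m 0), mul_one, sq]

/-- On average over the dilations, the points at irrational distance do not interfere. -/
theorem exists_large_jumpSum (h4 : 4 ≤ ∑ x ∈ X, (w x) ^ 2)
    (hs : ∀ x ∈ X, ∀ y ∈ X, ∀ m : ℕ, 0 < m → ∀ k : ℤ, m * (p x - p y) = k → 0 ≤ w x * w y) :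
    ∃ N : ℕ, 0 < N ∧ Real.pi ^ 2 / 2 < ‖jumpSum X w (fun x => (N : ℝ) * p x) 1‖ ^ 2 +
      ‖jumpSum X w (fun x => (N : ℝ) * p x) 2‖ ^ 2 / 4 := by
  by_contra! hsmall
  have hlim := (tendsto_average_norm_sq_jumpSum X w p 1).add
    ((tendsto_average_norm_sq_jumpSum X w p 2).div_const 4)
  have hle := le_of_tendsto hlim (b := Real.pi ^ 2 / 2) (by
    filter_upwards [eventually_gt_atTop 0] with M hM
    rw [div_right_comm, ← add_div, div_le_iff₀ (Nat.cast_pos.2 hM), Finset.sum_div,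
      ← Finset.sum_add_distrib]
    calc _ ≤ ∑ N ∈ Finset.range M, Real.pi ^ 2 / 2 :=
          Finset.sum_le_sum fun N _ => hsmall (N + 1) N.succ_pos
      _ = _ := by simp [mul_comm])
  have hone := sum_sq_le_average_norm_sq_jumpSum hs one_pos
  have htwo := sum_sq_le_average_norm_sq_jumpSum hs two_pos
  have h4' : (4 : ℝ) ≤ (∑ x ∈ X, w x ^ 2 : ℤ) := by exact_mod_cast h4
  push_cast at hone htwo h4'
  nlinarith [Real.pi_lt_d2, Real.pi_pos]

end jumpSum

/-! ### Reduction to arcs -/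

lemma totalJump_const (c : ℤ) : totalJump (fun _ => c) = 0 := by
  rw [totalJump_eq_sum ∅ (by simp) fun x _ hx => absurd (HasJump.const c x).jump_eq hx,
    Finset.sum_empty]

namespace IsStep

section ZeroOne

variable {f : ℝ → ℤ} (hf : IsStep f) (h01 : ∀ t, f t = 0 ∨ f t = 1)

include hf h01

lemma jump_eq_one_or_neg_one {x : ℝ} (hx : x ∈ hf.jumps) : jump f x = 1 ∨ jump f x = -1 := by
  obtain ⟨y, hy⟩ := (hf.hasJump x).1.exists
  have hne := (hf.mem_jumps.1 hx).2
  rcases h01 x with h | h <;> rcases h01 y with h' | h' <;> omega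

lemma totalJump_eq_card : totalJump f = hf.jumps.card := by
  rw [hf.totalJump_eq, Finset.card_eq_sum_ones]
  refine Finset.sum_congr rfl fun x hx => ?_
  rcases hf.jump_eq_one_or_neg_one h01 hx with h | h <;> rw [h] <;> rfl

lemma even_totalJump : Even (totalJump f) := by
  have hdvd : (2 : ℤ) ∣ ∑ x ∈ hf.jumps, (1 - jump f x) := by
    refine Finset.dvd_sum fun x hx => ?_
    rcases hf.jump_eq_one_or_neg_one h01 hx with h | h <;> rw [h] <;> norm_num
  rw [Finset.sum_sub_distrib, hf.sum_jump, sub_zero, Finset.sum_const, nsmul_eq_mul, mul_one]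
    at hdvd
  rw [hf.totalJump_eq_card h01]
  exact even_iff_two_dvd.2 (by exact_mod_cast hdvd)

/-- `fiberSum m` makes two jumps at distance `k / m` collide; when their signs are opposite they
cancel. -/
lemma totalJump_fiberSum_lt {x y : ℝ} (hx : x ∈ hf.jumps) (hy : y ∈ hf.jumps)
    (hxy : jump f x * jump f y < 0) {m : ℕ} (hm : 0 < m) {k : ℤ} (hk : m * (x - y) = k) :
    totalJump (_root_.fiberSum m f) < totalJump f := by
  obtain ⟨c, hc⟩ := hf.eq_staircase
  have hne : y ≠ x := by
    rintro rfl
    exact absurd hxy (not_lt.2 (mul_self_nonneg _))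
  have hopposite : jump f y = -jump f x := by
    rcases hf.jump_eq_one_or_neg_one h01 hx with h | h <;>
      rcases hf.jump_eq_one_or_neg_one h01 hy with h' | h' <;> rw [h, h'] at hxy <;> omega
  have hy' : y ∈ hf.jumps.erase x := Finset.mem_erase.2 ⟨hne, hy⟩
  have hcancel : _root_.fiberSum m f = staircase ((hf.jumps.erase x).erase y) (jump f)
      (fun z => m * id z) (m * c - jump f x * k) := by
    conv_lhs => rw [hc, fiberSum_staircase _ _ _ _ hm]
    ext t
    have hfloor : ⌊t - m * y⌋ = ⌊t - m * x⌋ + k := by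
      rw [← Int.floor_add_intCast, ← hk]
      ring_nf
    simp only [staircase, ← Finset.add_sum_erase _ _ hx, ← Finset.add_sum_erase _ _ hy', id,
      hfloor, hopposite]
    ring
  rw [hcancel, hf.totalJump_eq, ← Finset.add_sum_erase _ _ hx, ← Finset.add_sum_erase _ _ hy']
  have hpos := Int.natAbs_pos.2 (hf.mem_jumps.1 hx).2
  have hle := totalJump_staircase_le ((hf.jumps.erase x).erase y) (jump f) (fun z => m * id z)
    (m * c - jump f x * k)
  omega

end ZeroOne

lemma eq_or_eq_add_one_of_totalJump_superlevel {F : ℝ → ℤ} (hF : IsStep F) (h0 : ∀ t, 0 ≤ F t)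
    {n : ℕ} (hpos : 0 < totalJump (_root_.superlevel n F))
    (hn : totalJump F ≤ totalJump (_root_.superlevel n F)) (t : ℝ) : F t = n ∨ F t = n + 1 := by
  have hconst : ∀ m, m ≠ n → ∀ s, _root_.superlevel m F s = _root_.superlevel m F t := by
    intro m hm s
    obtain ⟨c, hc⟩ := (hF.superlevel m).eq_const_of_totalJump_eq_zero
      (by have := hF.totalJump_superlevel_add_le hm; omega)
    rw [hc, hc]
  have hnonconst : ∀ c, ¬ ∀ s, _root_.superlevel n F s = c := fun c hc => by
    rw [funext hc, totalJump_const] at hpos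
    exact hpos.false
  by_contra! hne
  rcases lt_or_ge (F t) n with hlt | hge
  · obtain ⟨m, rfl⟩ : ∃ m, n = m + 1 := ⟨n - 1, by have := h0 t; omega⟩
    refine hnonconst 0 fun s => ?_
    have h := hconst m (by omega) s
    simp only [_root_.superlevel] at h ⊢
    push_cast at *
    split_ifs at * <;> omega
  · refine hnonconst 1 fun s => ?_
    have h := hconst (n + 1) (by omega) s
    simp only [_root_.superlevel] at h ⊢
    push_cast at *
    split_ifs at * <;> omega

variable {f : ℝ → ℤ} (hf : IsStep f) (h01 : ∀ t, f t = 0 ∨ f t = 1)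

include hf h01

/-- Otherwise every `fiberSum N f` would take two adjacent values only, hence have variance at most
`1 / 4`, and no two jumps of opposite sign would lie at rational distance. -/
theorem exists_totalJump_superlevel_fiberSum_lt (hJ : 4 ≤ totalJump f) :
    ∃ N : ℕ, 0 < N ∧ ∀ n, totalJump (_root_.superlevel n (_root_.fiberSum N f)) < totalJump f := by
  by_contra! hcon
  have hsq : 4 ≤ ∑ x ∈ hf.jumps, jump f x ^ 2 := by
    rw [hf.totalJump_eq_card h01] at hJ
    rw [Finset.sum_congr rfl fun x hx => sq_eq_one_iff.2
      (hf.jump_eq_one_or_neg_one h01 hx), Finset.sum_const, nsmul_eq_mul, mul_one]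
    exact_mod_cast hJ
  have hsign : ∀ x ∈ hf.jumps, ∀ y ∈ hf.jumps, ∀ m : ℕ, 0 < m → ∀ k : ℤ,
      m * (id x - id y) = k → 0 ≤ jump f x * jump f y := by
    intro x hx y hy m hm k hk
    by_contra! hneg
    obtain ⟨n, hn⟩ := hcon m hm
    exact (hn.trans ((hf.fiberSum hm).totalJump_superlevel_le n)).not_gt
      (hf.totalJump_fiberSum_lt h01 hx hy hneg hm hk)
  obtain ⟨N, hN, hlarge⟩ := exists_large_jumpSum hsq hsign
  obtain ⟨n, hn⟩ := hcon N hN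
  have hnonneg : ∀ t, 0 ≤ _root_.fiberSum N f t := fun t => Finset.sum_nonneg fun j _ => by
    rcases h01 ((t + j) / N) with h | h <;> simp [h]
  have htwo := (hf.fiberSum hN).eq_or_eq_add_one_of_totalJump_superlevel hnonneg (by omega)
    ((hf.totalJump_fiberSum_le hN).trans hn)
  obtain ⟨c, hc⟩ := hf.eq_staircase
  rw [hc, fiberSum_staircase _ _ _ _ hN] at htwo
  exact hlarge.not_ge (norm_sq_jumpSum_le_of_two_valued _ _ _ hf.sum_jump htwo)

lemma eq_arcIndicator_of_jumps_eq_pair {x y : ℝ} (hxy : x ≠ y) (hjumps : hf.jumps = {x, y})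
    (hx : jump f x = 1) : f = arcIndicator x (Int.fract (y - x)) := by
  have hxI := (hf.mem_jumps.1 (show x ∈ hf.jumps by simp [hjumps])).1
  have hyI := (hf.mem_jumps.1 (show y ∈ hf.jumps by simp [hjumps])).1
  have hy : jump f y = -1 := by
    have hsum := hf.sum_jump
    rw [hjumps, Finset.sum_pair hxy] at hsum
    omega
  have hpos : 0 < Int.fract (y - x) := by
    refine (Int.fract_nonneg _).lt_of_ne' fun h0 => hxy ?_
    rw [(fract_sub_eq_zero_iff hyI).1 h0, Int.fract_eq_self.2 hxI]
  have hlt := Int.fract_lt_one (y - x)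
  obtain ⟨c, hc⟩ := hf.eq_staircase
  have hform : ∀ t, f t = (c + ⌊y - x⌋) + arcIndicator x (Int.fract (y - x)) t := by
    intro t
    have hfract := arcIndicator_add_intCast x (Int.fract (y - x)) ⌊y - x⌋ t
    rw [Int.fract_add_floor] at hfract
    have harc : f t = c + arcIndicator x (y - x) t := by
      conv_lhs => rw [hc]
      simp only [staircase, arcIndicator, hjumps, Finset.sum_pair hxy, hx, hy, id, sub_sub,
        add_sub_cancel]
      ring
    rw [harc, hfract]
    ring
  have hzero : c + ⌊y - x⌋ = 0 := by
    have hstart := hform x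
    have hend := hform (x + Int.fract (y - x))
    rw [arcIndicator_eq_ite hpos.le hlt, sub_self, Int.fract_zero, if_pos hpos] at hstart
    rw [arcIndicator_eq_ite hpos.le hlt, add_sub_cancel_left, Int.fract_fract,
      if_neg (lt_irrefl _)] at hend
    rcases h01 x with h | h <;> rcases h01 (x + Int.fract (y - x)) with h' | h' <;> omega
  exact funext fun t => by rw [hform, hzero, zero_add]

lemma exists_eq_arcIndicator (hJ : totalJump f ≤ 2) :
    ∃ p, ∃ β : unitInterval, f = arcIndicator p β := by
  have hcard := hf.totalJump_eq_card h01
  obtain ⟨r, hr⟩ := hf.even_totalJump h01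
  obtain hempty | hpair : hf.jumps.card = 0 ∨ hf.jumps.card = 2 := by omega
  · obtain ⟨c, hc⟩ := hf.eq_const_of_totalJump_eq_zero (hcard.trans hempty)
    rcases h01 0 with h | h <;> rw [hc] at h <;> subst h
    · exact ⟨0, 0, funext fun t => by rw [hc, Set.Icc.coe_zero, arcIndicator_zero]⟩
    · exact ⟨0, 1, funext fun t => by rw [hc, Set.Icc.coe_one, arcIndicator_one]⟩
  · obtain ⟨x, y, hxy, hjumps⟩ := Finset.card_eq_two.1 hpair
    have hβ : ∀ z : ℝ, Int.fract z ∈ unitInterval := fun z =>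
      ⟨Int.fract_nonneg z, (Int.fract_lt_one z).le⟩
    have hsum := hf.sum_jump
    rw [hjumps, Finset.sum_pair hxy] at hsum
    rcases hf.jump_eq_one_or_neg_one h01 (show x ∈ hf.jumps by simp [hjumps]) with hx | hx
    · exact ⟨x, ⟨_, hβ _⟩, hf.eq_arcIndicator_of_jumps_eq_pair h01 hxy hjumps hx⟩
    · exact ⟨y, ⟨_, hβ _⟩, hf.eq_arcIndicator_of_jumps_eq_pair h01 hxy.symm
        (by rw [hjumps, Finset.pair_comm]) (by omega)⟩

end IsStep

theorem hasNestedRieszSpectra {ι : Type*} [Finite ι] [Preorder ι] {f : ι → ℝ → ℤ}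
    (hf : Monotone f) (hstep : ∀ k, IsStep (f k)) (h01 : ∀ k t, f k t = 0 ∨ f k t = 1) :
    HasNestedRieszSpectra f := by
  cases nonempty_fintype ι
  induction hs : ∑ k, totalJump (f k) using Nat.strong_induction_on generalizing f with
  | _ s ih =>
    by_cases! harcs : ∀ k, totalJump (f k) ≤ 2
    · exact hasNestedRieszSpectra_of_arcs hf fun k => (hstep k).exists_eq_arcIndicator (h01 k)
        (harcs k)
    obtain ⟨k₀, hk₀⟩ := harcs
    obtain ⟨r, hr⟩ := (hstep k₀).even_totalJump (h01 k₀)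
    obtain ⟨N, hN, hlt⟩ :=
      (hstep k₀).exists_totalJump_superlevel_fiberSum_lt (h01 k₀) (by omega)
    have hsuperlevel : ∀ n : ℕ, HasNestedRieszSpectra fun k => superlevel n (fiberSum N (f k)) := by
      intro n
      refine ih _ ?_ (fun k l hkl => superlevel_mono (fiberSum_mono (hf hkl) N) n)
        (fun k => ((hstep k).fiberSum hN).superlevel n)
        (fun k => superlevel_eq_zero_or_one n _) rfl
      rw [← hs]
      exact Finset.sum_lt_sum (fun k _ => (((hstep k).fiberSum hN).totalJump_superlevel_le n).trans
        ((hstep k).totalJump_fiberSum_le hN)) ⟨k₀, Finset.mem_univ _, hlt n⟩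
    choose Λ hmono hΛ using hsuperlevel
    refine ⟨fun k => {m | m / (N : ℤ) ∈ Λ (m % (N : ℤ)).toNat k},
      fun k l hkl m hm => hmono _ hkl hm, fun k => ?_⟩
    have hind : IsCircleIndicator (f k) := ⟨(hstep k).measurable, (hstep k).periodic, h01 k⟩
    exact hind.isRieszSpectrum_of_fiberSum (Λ := fun n => Λ n k) hN fun n _ => hΛ n k

/-! ### Riesz bases and the analysis operator -/

section Analysis

lemma isUnit_adjoint_comp_self {𝕜 E F : Type*} [RCLike 𝕜] [NormedAddCommGroup E]
    [InnerProductSpace 𝕜 E] [CompleteSpace E] [NormedAddCommGroup F] [InnerProductSpace 𝕜 F]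
    [CompleteSpace F] (e : E ≃L[𝕜] F) :
    IsUnit (ContinuousLinearMap.adjoint (e : E →L[𝕜] F) ∘L (e : E →L[𝕜] F)) := by
  set S : F →L[𝕜] E := (e.symm : F →L[𝕜] E) with hS
  have hadj : ContinuousLinearMap.adjoint (e : E →L[𝕜] F) ∘L S.adjoint =
      ContinuousLinearMap.id 𝕜 E := by
    rw [← ContinuousLinearMap.adjoint_comp, hS, e.coe_symm_comp_coe,
      ContinuousLinearMap.adjoint_id]
  have hadj' : S.adjoint ∘L ContinuousLinearMap.adjoint (e : E →L[𝕜] F) =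
      ContinuousLinearMap.id 𝕜 F := by
    rw [← ContinuousLinearMap.adjoint_comp, hS, e.coe_comp_coe_symm,
      ContinuousLinearMap.adjoint_id]
  refine ⟨⟨_, S ∘L S.adjoint, ?_, ?_⟩, rfl⟩ <;> ext x
  · simpa [hS] using congr($hadj x)
  · simpa [hS] using congrArg e.symm congr($hadj' (e x))

variable {H K : Type*} [NormedAddCommGroup H] [InnerProductSpace ℂ H] [CompleteSpace H]

theorem exists_polar_decomposition [NormedAddCommGroup K] [InnerProductSpace ℂ K]
    [CompleteSpace K] (e : H ≃L[ℂ] K) : ∃ (T : H ≃L[ℂ] H) (U : H ≃ₗᵢ[ℂ] K),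
      (∀ x y, inner ℂ (T x) y = inner ℂ x (T y)) ∧ ∀ x, U (T x) = e x := by
  let R : H →L[ℂ] H := ContinuousLinearMap.adjoint (e : H →L[ℂ] K) ∘L (e : H →L[ℂ] K)
  have hR : 0 ≤ R := by
    rw [ContinuousLinearMap.nonneg_iff_isPositive]
    exact ContinuousLinearMap.isPositive_adjoint_comp_self (e : H →L[ℂ] K)
  obtain ⟨u, hu⟩ := (CFC.isUnit_sqrt_iff R hR).2 (isUnit_adjoint_comp_self e)
  let T : H ≃L[ℂ] H := ContinuousLinearEquiv.ofUnit u
  have hT (x : H) : T x = CFC.sqrt R x := congr($hu x)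
  have hTT (x : H) : T (T x) = R x := by
    rw [hT, hT]
    exact congr($(CFC.sqrt_mul_sqrt_self R hR) x)
  have hsymm (x y : H) : inner ℂ (T x) y = inner ℂ x (T y) := by
    rw [hT, hT, ← ContinuousLinearMap.adjoint_inner_right,
      (CFC.sqrt_nonneg R).isSelfAdjoint.adjoint_eq]
  have hnorm (x : H) : ‖e x‖ = ‖T x‖ := by
    have hinner : inner ℂ (e x) (e x) = inner ℂ (T x) (T x) := by
      rw [hsymm, hTT]
      exact (ContinuousLinearMap.adjoint_inner_right (e : H →L[ℂ] K) x (e x)).symm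
    rw [inner_self_eq_norm_sq_to_K, inner_self_eq_norm_sq_to_K] at hinner
    exact (sq_eq_sq₀ (norm_nonneg _) (norm_nonneg _)).1 (by exact_mod_cast hinner)
  refine ⟨T, ⟨(T.symm.trans e).toLinearEquiv, fun x => ?_⟩, hsymm, fun x => ?_⟩
  · exact (hnorm (T.symm x)).trans (by rw [T.apply_symm_apply])
  · exact congrArg e (T.symm_apply_apply x)

/-- The analysis operator of a family of vectors: the sequence of inner products with the family. -/
noncomputable def analysisMap {ι E : Type*} [NormedAddCommGroup E] [InnerProductSpace ℂ E]
    (f : ι → E) (hf : ∀ g, Memℓp (fun i => inner ℂ (f i) g) 2) :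
    E →ₗ[ℂ] lp (fun _ : ι => ℂ) 2 where
  toFun g := ⟨fun i => inner ℂ (f i) g, hf g⟩
  map_add' _ _ := by ext i; exact inner_add_right _ _ _
  map_smul' _ _ := by ext i; exact inner_smul_right _ _ _

variable {ι : Type*} {f : ι → H} (hf : ∀ g, Memℓp (fun i => inner ℂ (f i) g) 2)

include hf

lemma continuous_analysisMap : Continuous (analysisMap f hf) := by
  refine LinearMap.continuous_of_seq_closed_graph _ fun u x y hu hy => ?_
  ext i
  have hinner : Tendsto (fun n => inner ℂ (f i) (u n)) atTop (𝓝 (inner ℂ (f i) x)) :=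
    tendsto_const_nhds.inner hu
  exact tendsto_nhds_unique
    (((lp.evalCLM ℂ (fun _ : ι => ℂ) 2 i).continuous.tendsto y).comp hy) hinner

/-- If `U T` is the polar decomposition of the analysis operator, then `f i = T (U⁻¹ (δ i))`. -/
theorem isRieszBasis_of_bijective_analysisMap (hbij : Function.Bijective (analysisMap f hf)) :
    IsRieszBasis f := by
  classical
  let e : H ≃L[ℂ] lp (fun _ : ι => ℂ) 2 :=
    (LinearEquiv.ofBijective _ hbij).toContinuousLinearEquivOfContinuous (continuous_analysisMap hf)
  have he (g : H) (i : ι) : e g i = inner ℂ (f i) g := rfl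
  obtain ⟨T, U, hsymm, hU⟩ := exists_polar_decomposition e
  refine ⟨HilbertBasis.ofRepr U, T, fun i => ext_inner_right ℂ fun g => ?_⟩
  rw [hsymm, ← HilbertBasis.repr_symm_single]
  change inner ℂ (f i) g = inner ℂ (U.symm (lp.single 2 i 1)) (T g)
  rw [← U.inner_map_map (U.symm _), U.apply_symm_apply, hU, lp.inner_single_left, he]
  simp

end Analysis

/-! ### From Riesz spectra to Riesz bases of exponentials -/

lemma norm_expFun (x t : ℝ) : ‖expFun x t‖ = 1 := by
  rw [expFun, show 2 * (Real.pi : ℂ) * Complex.I * x * t = ((2 * Real.pi * x * t : ℝ) : ℂ) *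
    Complex.I by push_cast; ring, Complex.norm_exp_ofReal_mul_I]

lemma memLp_expFun (x : ℝ) (p : ENNReal) (μ : Measure ℝ) [IsFiniteMeasure μ] :
    MemLp (expFun x) p μ := by
  refine MemLp.of_bound (C := 1) (Continuous.aestronglyMeasurable ?_)
    (Eventually.of_forall fun t => (norm_expFun x t).le)
  unfold expFun
  fun_prop

lemma expFun_eq_conj_conjExp (n : ℤ) (t : ℝ) : expFun n t = (starRingEnd ℂ) (conjExp n t) := by
  rw [← conjExp_neg, expFun, conjExp]
  congr 1
  push_cast
  ring

lemma exists_periodicL2_unitFourierCoeff_eq_subtype (Λ : Set ℤ) (c : lp (fun _ : Λ => ℂ) 2) :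
    ∃ h, PeriodicL2 h ∧ ∀ n : Λ, unitFourierCoeff h n = c n := by
  let c₀ : ℤ → ℂ := Function.extend Subtype.val c 0
  have hc₀ (n : Λ) : c₀ n = c n := Subtype.val_injective.extend_apply _ _ n
  have hsummable : Summable fun n => ‖c₀ n‖ ^ 2 := by
    refine (Subtype.val_injective.summable_iff (g := ((↑) : Λ → ℤ)) fun n hn => ?_).1 ?_
    · simp [c₀, Function.extend_apply' _ _ _ hn]
    · simpa [Function.comp_def, hc₀] using (lp.memℓp c).summable (by simp)
  obtain ⟨h, hh, hcoeff⟩ :=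
    exists_periodicL2_unitFourierCoeff_eq ⟨c₀, memℓp_two_of_summable hsummable⟩
  exact ⟨h, hh, fun n => (hcoeff n).trans (hc₀ n)⟩

/-- The points at which `f` is one, in the fundamental domain `(0, 1]` of the circle. -/
def unitSupport (f : ℝ → ℤ) : Set ℝ := Set.Ioc 0 1 ∩ f ⁻¹' {1}

instance isFiniteMeasure_restrict_unitSupport (f : ℝ → ℤ) :
    IsFiniteMeasure (volume.restrict (unitSupport f)) :=
  isFiniteMeasure_restrict.2
    ((measure_mono Set.inter_subset_left).trans_lt measure_Ioc_lt_top).ne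

namespace IsCircleIndicator

variable {f : ℝ → ℤ} (hf : IsCircleIndicator f)

include hf

lemma measurableSet_unitSupport : MeasurableSet (unitSupport f) :=
  measurableSet_Ioc.inter (hf.measurable (measurableSet_singleton 1))

lemma exists_periodic_extension {g : ℝ → ℂ} (hg : Measurable g)
    (hL : MemLp g 2 (volume.restrict (unitSupport f))) :
    ∃ G, PeriodicL2 G ∧ (∀ t, f t = 0 → G t = 0) ∧ G =ᵐ[volume.restrict (unitSupport f)] g := by
  have hmeas : MeasurableSet (f ⁻¹' {1}) := hf.measurable (measurableSet_singleton 1)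
  set G : ℝ → ℂ := (f ⁻¹' {1}).indicator fun t => g (t - ⌈t⌉ + 1) with hG
  have hGm : Measurable G :=
    (hg.comp ((measurable_id.sub (measurable_from_top.comp Int.measurable_ceil)).add_const
      1)).indicator hmeas
  have hGp : Function.Periodic G 1 := fun t => by
    simp only [hG, Set.indicator, Set.mem_preimage, hf.periodic t, Int.ceil_add_one, Int.cast_add,
      Int.cast_one, add_sub_add_right_eq_sub]
  have hunit : ∀ t ∈ Set.Ioc (0 : ℝ) 1, G t = (f ⁻¹' {1}).indicator g t := fun t ht => by
    have hceil : ⌈t⌉ = 1 := Int.ceil_eq_iff.2 (by simpa using ht)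
    simp only [hG, Set.indicator, hceil, Int.cast_one, sub_add_cancel]
  refine ⟨G, PeriodicL2.of_memLp hGm hGp ?_, fun t ht => Set.indicator_of_notMem (by simp [ht]) _,
    (ae_restrict_iff' hf.measurableSet_unitSupport).2 (Eventually.of_forall fun t ht => ?_)⟩
  · rw [unitSupport, Set.inter_comm, ← Measure.restrict_restrict hmeas,
      ← memLp_indicator_iff_restrict hmeas] at hL
    exact hL.ae_eq ((ae_restrict_mem measurableSet_Ioc).mono fun t ht => (hunit t ht).symm)
  · rw [hunit t ht.1, Set.indicator_of_mem ht.2]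

lemma setIntegral_eq_unitFourierCoeff {G : ℝ → ℂ} (hG : ∀ t, f t = 0 → G t = 0) (n : ℤ) :
    ∫ t in unitSupport f, G t * conjExp n t = unitFourierCoeff G n := by
  rw [unitFourierCoeff, intervalIntegral.integral_of_le zero_le_one]
  refine (setIntegral_eq_of_subset_of_forall_sdiff_eq_zero measurableSet_Ioc
    Set.inter_subset_left fun t ht => ?_).symm
  rw [hG t ((hf.eq_zero_or_one t).resolve_right fun hone => ht.2 ⟨ht.1, hone⟩), zero_mul]

lemma inner_expFun_eq_unitFourierCoeff (n : ℤ) (g : Lp ℂ 2 (volume.restrict (unitSupport f)))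
    {G : ℝ → ℂ} (hG : ∀ t, f t = 0 → G t = 0) (hGg : G =ᵐ[volume.restrict (unitSupport f)] g) :
    inner ℂ ((memLp_expFun n 2 _).toLp (expFun n)) g = unitFourierCoeff G n := by
  rw [L2.inner_def, ← hf.setIntegral_eq_unitFourierCoeff hG]
  refine integral_congr_ae ?_
  filter_upwards [(memLp_expFun n 2 (volume.restrict (unitSupport f))).coeFn_toLp, hGg]
    with t hexp hg
  rw [hexp, hg, expFun_eq_conj_conjExp, RCLike.inner_apply, RCLike.conj_conj]

theorem isExpRieszBasis_of_isRieszSpectrum {Λ : Set ℤ} (hΛ : IsRieszSpectrum f Λ) :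
    IsExpRieszBasis (fun n : Λ => ((n : ℤ) : ℝ)) (unitSupport f) := by
  have hext (g : Lp ℂ 2 (volume.restrict (unitSupport f))) :=
    hf.exists_periodic_extension (Lp.stronglyMeasurable g).measurable (Lp.memLp g)
  refine ⟨fun n => (memLp_expFun n 2 _).toLp (expFun n), fun n => MemLp.coeFn_toLp _,
    isRieszBasis_of_bijective_analysisMap (fun g => ?_)
      ⟨(injective_iff_map_eq_zero _).2 fun g hg => ?_, fun c => ?_⟩⟩
  · obtain ⟨G, hG, hG0, hGg⟩ := hext g
    simp only [hf.inner_expFun_eq_unitFourierCoeff _ g hG0 hGg]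
    exact memℓp_two_of_summable
      (hG.summable_sq_unitFourierCoeff.comp_injective Subtype.val_injective)
  · obtain ⟨G, hG, hG0, hGg⟩ := hext g
    have hGzero := hΛ.ae_eq_zero G hG hG0 fun n hn =>
      (hf.inner_expFun_eq_unitFourierCoeff n g hG0 hGg).symm.trans
        congr(($hg : ∀ _, ℂ) ⟨n, hn⟩)
    exact (Lp.eq_zero_iff_ae_eq_zero).2 (hGg.symm.trans (ae_restrict_of_ae hGzero))
  · obtain ⟨h, hh, hcoeff⟩ := exists_periodicL2_unitFourierCoeff_eq_subtype Λ c
    obtain ⟨G, hG, hG0, hGh⟩ := hΛ.exists_eq h hh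
    have hGL : MemLp G 2 (volume.restrict (unitSupport f)) :=
      hG.memLp.mono_measure (Measure.restrict_mono Set.inter_subset_left le_rfl)
    refine ⟨hGL.toLp G, lp.ext (funext fun n => ?_)⟩
    exact (hf.inner_expFun_eq_unitFourierCoeff n _ hG0 hGL.coeFn_toLp.symm).trans
      ((hGh n n.2).trans (hcoeff n))

end IsCircleIndicator

/-! ### Finite unions of intervals as step functions -/

lemma eventually_mem_or_eventually_notMem_nhdsGT {α : Type*} [LinearOrder α] [TopologicalSpace α]
    [OrderTopology α] {I : Set α} (hI : I.OrdConnected) (x : α) :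
    (∀ᶠ y in 𝓝[>] x, y ∈ I) ∨ ∀ᶠ y in 𝓝[>] x, y ∉ I := by
  by_cases hfreq : ∃ᶠ y in 𝓝[>] x, y ∈ I
  · obtain ⟨z, hz, hxz⟩ := (hfreq.and_eventually self_mem_nhdsWithin).exists
    left
    filter_upwards [Ioo_mem_nhdsGT hxz] with y hy
    obtain ⟨u, hu, hxu⟩ := (hfreq.and_eventually (Ioo_mem_nhdsGT hy.1)).exists
    exact hI.out hu hz ⟨hxu.2.le, hy.2.le⟩
  · exact Or.inr (not_frequently.1 hfreq)

lemma eventually_mem_or_eventually_notMem_nhdsLT {α : Type*} [LinearOrder α] [TopologicalSpace α]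
    [OrderTopology α] {I : Set α} (hI : I.OrdConnected) (x : α) :
    (∀ᶠ y in 𝓝[<] x, y ∈ I) ∨ ∀ᶠ y in 𝓝[<] x, y ∉ I :=
  eventually_mem_or_eventually_notMem_nhdsGT (α := αᵒᵈ) hI.dual x

lemma eventually_mem_or_eventually_notMem_nhds {X : Type*} [TopologicalSpace X] {s : Set X} {x : X}
    (hx : x ∉ frontier s) : (∀ᶠ y in 𝓝 x, y ∈ s) ∨ ∀ᶠ y in 𝓝 x, y ∉ s := by
  rw [frontier, Set.mem_sdiff, not_and_or, not_not, mem_closure_iff_frequently,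
    not_frequently] at hx
  exact hx.symm.imp_left mem_interior_iff_mem_nhds.1

lemma eventually_mem_or_eventually_notMem_iUnion {α ι : Type*} [Finite ι] {I : ι → Set α}
    {l : Filter α} (h : ∀ i, (∀ᶠ y in l, y ∈ I i) ∨ ∀ᶠ y in l, y ∉ I i) :
    (∀ᶠ y in l, y ∈ ⋃ i, I i) ∨ ∀ᶠ y in l, y ∉ ⋃ i, I i := by
  by_cases hmem : ∃ i, ∀ᶠ y in l, y ∈ I i
  · obtain ⟨i, hi⟩ := hmem
    exact Or.inl (hi.mono fun y hy => Set.mem_iUnion.2 ⟨i, hy⟩)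
  · right
    simp only [Set.mem_iUnion, not_exists]
    exact eventually_all.2 fun i => (h i).resolve_left fun hi => hmem ⟨i, hi⟩

/-- The right-continuous function of period one that indicates a subset `S` of the unit interval,
up to finitely many points of a period if `S` is a finite union of intervals. -/
noncomputable def rightIndicator (S : Set ℝ) (t : ℝ) : ℤ :=
  open Classical in if ∀ᶠ y in 𝓝[>] t, Int.fract y ∈ S then 1 else 0

section RightIndicator

variable {S T : Set ℝ} {t : ℝ}

lemma rightIndicator_eq_zero_or_one (S : Set ℝ) (t : ℝ) :
    rightIndicator S t = 0 ∨ rightIndicator S t = 1 := by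
  unfold rightIndicator
  split_ifs <;> simp

lemma rightIndicator_eq_one (h : ∀ᶠ y in 𝓝[>] t, Int.fract y ∈ S) : rightIndicator S t = 1 :=
  if_pos h

lemma rightIndicator_eq_zero (h : ∀ᶠ y in 𝓝[>] t, Int.fract y ∉ S) : rightIndicator S t = 0 :=
  if_neg fun hmem => (h.and hmem).exists.elim fun _ hy => hy.1 hy.2

lemma rightIndicator_mono (h : S ⊆ T) : rightIndicator S ≤ rightIndicator T := fun t => by
  unfold rightIndicator
  split_ifs with hS hT
  · rfl
  · exact absurd (hS.mono fun y hy => h hy) hT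
  · exact zero_le_one
  · rfl

open Classical in
lemma periodic_rightIndicator (S : Set ℝ) : Function.Periodic (rightIndicator S) 1 := fun t => by
  have hshift : (∀ᶠ y in 𝓝[>] (t + 1), Int.fract y ∈ S) ↔ ∀ᶠ y in 𝓝[>] t, Int.fract y ∈ S := by
    simp only [← map_add_right_nhdsGT, eventually_map, Int.fract_add_one]
  unfold rightIndicator
  exact if_congr hshift rfl rfl

lemma mem_iff_rightIndicator_eq_one (ht : t ∈ Set.Ioo (0 : ℝ) 1)
    (hS : (∀ᶠ y in 𝓝 t, y ∈ S) ∨ ∀ᶠ y in 𝓝 t, y ∉ S) : t ∈ S ↔ rightIndicator S t = 1 := by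
  have hfract : ∀ᶠ y in 𝓝 t, Int.fract y = y := by
    filter_upwards [isOpen_Ioo.mem_nhds ht] with y hy
    exact Int.fract_eq_self.2 ⟨hy.1.le, hy.2⟩
  rcases hS with h | h
  · refine iff_of_true h.self_of_nhds (rightIndicator_eq_one (Eventually.filter_mono
      nhdsWithin_le_nhds ?_))
    filter_upwards [h, hfract] with y hy hfract
    rwa [hfract]
  · have hzero : rightIndicator S t = 0 := by
      refine rightIndicator_eq_zero (Eventually.filter_mono nhdsWithin_le_nhds ?_)
      filter_upwards [h, hfract] with y hy hfract
      rwa [hfract]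
    exact iff_of_false h.self_of_nhds (by rw [hzero]; exact zero_ne_one)

end RightIndicator

lemma eventually_eventually_nhdsGT {α : Type*} [Preorder α] [TopologicalSpace α] {P : α → Prop}
    {x : α} (h : ∀ᶠ y in 𝓝[>] x, P y) : ∀ᶠ y in 𝓝[>] x, ∀ᶠ z in 𝓝[>] y, P z := by
  filter_upwards [eventually_eventually_nhdsWithin.2 h, self_mem_nhdsWithin] with y hy hxy
  exact hy.filter_mono (nhdsWithin_mono y (Set.Ioi_subset_Ioi (le_of_lt hxy)))

lemma eventually_eventually_nhdsLT_nhdsGT {α : Type*} [LinearOrder α] [TopologicalSpace α]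
    [OrderClosedTopology α] {P : α → Prop} {x : α} (h : ∀ᶠ y in 𝓝[<] x, P y) :
    ∀ᶠ y in 𝓝[<] x, ∀ᶠ z in 𝓝[>] y, P z := by
  filter_upwards [eventually_eventually_nhdsWithin.2 h, self_mem_nhdsWithin] with y hy hxy
  rw [isOpen_Iio.nhdsWithin_eq hxy] at hy
  exact hy.filter_mono nhdsWithin_le_nhds

namespace IsFiniteUnionOfIntervals

variable {S : Set ℝ} (hS : IsFiniteUnionOfIntervals S)

include hS

lemma preimage_sub (a : ℝ) : IsFiniteUnionOfIntervals ((fun y => y - a) ⁻¹' S) := by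
  obtain ⟨L, I, hI, rfl⟩ := hS
  exact ⟨L, fun l => (fun y => y - a) ⁻¹' I l,
    fun l => (hI l).preimage_mono fun x y hxy => sub_le_sub_right hxy a, Set.preimage_iUnion⟩

lemma eventually_mem_or_nhdsGT (x : ℝ) : (∀ᶠ y in 𝓝[>] x, y ∈ S) ∨ ∀ᶠ y in 𝓝[>] x, y ∉ S := by
  obtain ⟨L, I, hI, rfl⟩ := hS
  exact eventually_mem_or_eventually_notMem_iUnion fun i =>
    eventually_mem_or_eventually_notMem_nhdsGT (hI i) x

lemma eventually_mem_or_nhdsLT (x : ℝ) : (∀ᶠ y in 𝓝[<] x, y ∈ S) ∨ ∀ᶠ y in 𝓝[<] x, y ∉ S := by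
  obtain ⟨L, I, hI, rfl⟩ := hS
  exact eventually_mem_or_eventually_notMem_iUnion fun i =>
    eventually_mem_or_eventually_notMem_nhdsLT (hI i) x

lemma ae_eventually_mem_or : ∀ᵐ x, (∀ᶠ y in 𝓝 x, y ∈ S) ∨ ∀ᶠ y in 𝓝 x, y ∉ S := by
  obtain ⟨L, I, hI, rfl⟩ := hS
  filter_upwards [ae_all_iff.2 fun i => measure_eq_zero_iff_ae_notMem.1
    ((hI i).convex.addHaar_frontier volume)] with x hx
  exact eventually_mem_or_eventually_notMem_iUnion fun i =>
    eventually_mem_or_eventually_notMem_nhds (hx i)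

lemma eventually_fract_mem_or_nhdsGT (x : ℝ) :
    (∀ᶠ y in 𝓝[>] x, Int.fract y ∈ S) ∨ ∀ᶠ y in 𝓝[>] x, Int.fract y ∉ S := by
  have hfloor : ∀ᶠ y in 𝓝[>] x, ⌊y⌋ = ⌊x⌋ :=
    (tendsto_pure.1 (tendsto_floor_right_pure_floor x)).filter_mono (nhdsWithin_mono x
      Set.Ioi_subset_Ici_self)
  refine ((hS.preimage_sub ⌊x⌋).eventually_mem_or_nhdsGT x).imp (fun h => ?_) fun h => ?_ <;>
  · filter_upwards [h, hfloor] with y hy hfloor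
    rwa [Int.fract, hfloor]

lemma eventually_fract_mem_or_nhdsLT (x : ℝ) :
    (∀ᶠ y in 𝓝[<] x, Int.fract y ∈ S) ∨ ∀ᶠ y in 𝓝[<] x, Int.fract y ∉ S := by
  have hfloor := tendsto_pure.1 (tendsto_floor_left_pure_ceil_sub_one x)
  refine ((hS.preimage_sub ((⌈x⌉ - 1 : ℤ) : ℝ)).eventually_mem_or_nhdsLT x).imp
    (fun h => ?_) fun h => ?_ <;>
  · filter_upwards [h, hfloor] with y hy hfloor
    rwa [Int.fract, hfloor]

lemma isStep_rightIndicator : IsStep (rightIndicator S) := by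
  refine ⟨periodic_rightIndicator S, fun x => ?_⟩
  have hright : ∀ᶠ y in 𝓝[>] x, rightIndicator S y = rightIndicator S x := by
    rcases hS.eventually_fract_mem_or_nhdsGT x with h | h
    · filter_upwards [eventually_eventually_nhdsGT h] with y hy
      rw [rightIndicator_eq_one h, rightIndicator_eq_one hy]
    · filter_upwards [eventually_eventually_nhdsGT h] with y hy
      rw [rightIndicator_eq_zero h, rightIndicator_eq_zero hy]
  rcases hS.eventually_fract_mem_or_nhdsLT x with h | h
  · refine ⟨rightIndicator S x - 1, ?_, hright⟩
    filter_upwards [eventually_eventually_nhdsLT_nhdsGT h] with y hy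
    rw [rightIndicator_eq_one hy, sub_sub_cancel]
  · refine ⟨rightIndicator S x, ?_, hright⟩
    filter_upwards [eventually_eventually_nhdsLT_nhdsGT h] with y hy
    rw [rightIndicator_eq_zero hy, sub_self]

lemma isCircleIndicator_rightIndicator : IsCircleIndicator (rightIndicator S) :=
  ⟨hS.isStep_rightIndicator.measurable, periodic_rightIndicator S, rightIndicator_eq_zero_or_one S⟩

lemma ae_eq_unitSupport_rightIndicator (h01 : S ⊆ Set.Icc 0 1) :
    S =ᵐ[volume] unitSupport (rightIndicator S) := by
  rw [eventuallyEq_set]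
  filter_upwards [hS.ae_eventually_mem_or, Measure.ae_ne volume 0, Measure.ae_ne volume 1]
    with t ht h0 h1
  by_cases hI : t ∈ Set.Ioo (0 : ℝ) 1
  · rw [mem_iff_rightIndicator_eq_one hI ht]
    exact (and_iff_right (Set.Ioo_subset_Ioc_self hI)).symm
  · exact iff_of_false
      (fun h => hI ⟨(h01 h).1.lt_of_ne h0.symm, (h01 h).2.lt_of_ne h1⟩)
      fun h => hI ⟨h.1.1, h.1.2.lt_of_ne h1⟩

end IsFiniteUnionOfIntervals

lemma IsExpRieszBasis.congr_ae {ι : Type*} {freq : ι → ℝ} {S T : Set ℝ}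
    (hT : IsExpRieszBasis freq T) (h : S =ᵐ[volume] T) : IsExpRieszBasis freq S := by
  unfold IsExpRieszBasis at hT ⊢
  rwa [Measure.restrict_congr_set h]

theorem mainTheorem7_general {ι : Type*} [Finite ι] [Preorder ι] (S : ι → Set ℝ)
    (hS : ∀ k, IsFiniteUnionOfIntervals (S k))
    (hmono : Monotone S)
    (h01 : ∀ k, S k ⊆ Set.Icc (0 : ℝ) 1) :
    ∃ Λ : ι → Set ℤ, Monotone Λ ∧
      ∀ k, IsExpRieszBasis (fun n : Λ k => ((n : ℤ) : ℝ)) (S k) := by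
  obtain ⟨Λ, hΛ, hspectrum⟩ := hasNestedRieszSpectra
    (fun k l hkl => rightIndicator_mono (hmono hkl))
    (fun k => (hS k).isStep_rightIndicator) fun k => rightIndicator_eq_zero_or_one (S k)
  refine ⟨Λ, hΛ, fun k => ?_⟩
  have hbasis :=
    (hS k).isCircleIndicator_rightIndicator.isExpRieszBasis_of_isRieszSpectrum (hspectrum k)
  exact hbasis.congr_ae ((hS k).ae_eq_unitSupport_rightIndicator (h01 k))

theorem mainTheorem7 (K : ℕ) (S : Fin K → Set ℝ)
    (hS : ∀ k, IsFiniteUnionOfIntervals (S k))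
    (hmono : Monotone S)
    (h01 : ∀ k, S k ⊆ Set.Icc (0 : ℝ) 1) :
    ∃ Λ : Fin K → Set ℤ, Monotone Λ ∧
      ∀ k, IsExpRieszBasis (fun n : Λ k => ((n : ℤ) : ℝ)) (S k) :=
  mainTheorem7_general S hS hmono h01
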